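/- Let $n\ge 2$ and let $\omega_k$ denote the area of the $(k-1)$-dimensional unit sphere in $\mathbb{R}^k$. Put $$C_n=\frac{4(n-1)^{(n-1)/2}\,\omega_{n-1}}{n^{n/2}\,\omega_n}.$$ Let $\Omega=\mathbb{R}^n\setminus\overline{G}$, where $G$ is a convex domain (nonempty, open, convex set) in $\mathbb{R}^n$, and let $u$ be a bounded harmonic function in $\Omega$. Then for every $x\in\Omega$ $$|\nabla u(x)|\le \frac{C_n}{d_x}\,\sup_{\Omega}|u|,$$ where $d_x$ is the distance from $x$ to $\partial\Omega$. Moreover, $C_n$ is the best constant in the inequality $$|\nabla u(x)|\le C_n\,x_n^{-1}\,\|u\|_{L^\infty(\partial\mathbb{R}^n_+)}$$ for bounded harmonic functions $u$ in the half-space $\mathbb{R}^n_+=\{x\in\mathbb{R}^n: x_n>0\}$: at every point $x\in\mathbb{R}^n_+$ the inequality holds for all such $u$, and it fails for some such $u$ if $C_n$ is replaced by a smaller constant. Here $\|u\|_{L^\infty(\partial\mathbb{R}^n_+)}$ is the $L^\infty$ norm of the boundary values of $u$, i.e. the essential supremum over $y\in\mathbb{R}^{n-1}$ of $\limsup_{t\to0^+}|u(y,t)|$.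 In particular, $C_2=2/\pi$ and $C_3=4/(3\sqrt3)$. -/

import Mathlib

open MeasureTheory Filter Topology InnerProductSpace
open scoped ENNReal

noncomputable section

/-- `ω_n`: the area of the `(n - 1)`-dimensional unit sphere in `ℝⁿ`, that is, the total mass of
the surface measure induced on it by Lebesgue measure. -/
def sphereArea (n : ℕ) : ℝ :=
  (volume : Measure (EuclideanSpace ℝ (Fin n))).toSphere.real Set.univ

/-- `C_n = 4 (n-1)^{(n-1)/2} ω_{n-1} / (n^{n/2} ω_n)` (used for `n ≥ 2`). -/
def gradConst (n : ℕ) : ℝ :=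
  4 * ((n : ℝ) - 1) ^ (((n : ℝ) - 1) / 2) * sphereArea (n - 1) /
    ((n : ℝ) ^ ((n : ℝ) / 2) * sphereArea n)

/-- `u` is a bounded harmonic function in `Ω`. -/
structure BoundedHarmonicOn {n : ℕ} (u : EuclideanSpace ℝ (Fin n) → ℝ)
    (Ω : Set (EuclideanSpace ℝ (Fin n))) : Prop where
  harmonic : HarmonicOnNhd u Ω
  bounded : ∃ M : ℝ, ∀ y ∈ Ω, |u y| ≤ M

/-- The open half-space of `ℝ^{m+1}` where the last coordinate is positive. -/
def upperHalfSpace (m : ℕ) : Set (EuclideanSpace ℝ (Fin (m + 1))) :=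
  {x | 0 < x (Fin.last m)}

/-- The point `(y, t)` of `ℝ^m × ℝ = ℝ^{m+1}`. -/
def halfSpacePoint {m : ℕ} (y : EuclideanSpace ℝ (Fin m)) (t : ℝ) :
    EuclideanSpace ℝ (Fin (m + 1)) :=
  WithLp.toLp 2 (Fin.snoc (α := fun _ => ℝ) y.ofLp t)

/-- The norm `‖u‖_{L^∞(∂ℝ^{m+1}_+)}` of the boundary values of a function `u` on the upper
half-space: the essential supremum over `y ∈ ℝ^m` (Lebesgue measure) of the size
`limsup_{t → 0+} |u(y, t)|` of `u` at the boundary point `(y, 0)`. If `u` has a boundary function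
`g`, this is the `L^∞` norm of `g`, see `boundaryNorm_eq`. -/
def boundaryNorm {m : ℕ} (u : EuclideanSpace ℝ (Fin (m + 1)) → ℝ) : ℝ≥0∞ :=
  essSup (fun y : EuclideanSpace ℝ (Fin m) =>
    limsup (fun t : ℝ => ‖u (halfSpacePoint y t)‖ₑ) (𝓝[>] 0)) volume

/-- If `u` has boundary values `g` almost everywhere, then `boundaryNorm u` is the usual
`L^∞` norm of `g`. -/
theorem boundaryNorm_eq {m : ℕ} {u : EuclideanSpace ℝ (Fin (m + 1)) → ℝ}
    {g : EuclideanSpace ℝ (Fin m) → ℝ}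
    (h : ∀ᵐ y, Tendsto (fun t : ℝ => u (halfSpacePoint y t)) (𝓝[>] 0) (𝓝 (g y))) :
    boundaryNorm u = eLpNorm g ∞ volume := by
  rw [eLpNorm_exponent_top, eLpNormEssSup]
  refine essSup_congr_ae ?_
  filter_upwards [h] with y hy
  exact hy.enorm.limsup_eq

end

/-!
In the half-space, the Poisson kernel of height `t` is `c x_n / ‖x‖ⁿ`, and the derivative of a
bounded harmonic function in a unit direction `v` is the integral of its boundary values against
the derivative of the kernel. The best constant for the direction `v` is therefore the `L¹` norm of
that derivative, which by homogeneity is `1 / t` times its value at height one.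

Central projection from the hyperplane `x_n = 1` to the unit ball (`setLIntegral_ball_eq`) turns
this norm into the mean over the ball of `|v_n - n x_n ⟪x, v⟫ / ‖x‖²|`, and shows that the kernel
has mass `ω_n / 2`. By polarization the quadratic form `n x_n ⟪x, v⟫ - v_n ‖x‖²` is a combination
with weights `‖v ± e‖² / 4`, of sum `1`, of the trace-free forms of the two bisectors of `v` and
the normal `e`, one of them with the opposite sign. The triangle inequality and rotation invariance
(`directionalForm_le`, `setIntegral_axialForm`) then show that `v = e` is the worst direction. For
`v = e` the kernel derivative is radial with an explicit primitive (`integral_Ioi_radial`), which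
gives `C_n`.

No boundary limits have to be constructed. Above height `ε` a bounded harmonic function is the
Poisson integral of its values at height `ε` (`BoundedHarmonicOn.eq_poissonIntegral`), by a
Phragmén–Lindelöf principle with a quadratic barrier; the reverse Fatou lemma lets `ε` tend to `0`
(`BoundedHarmonicOn.abs_fderiv_le`). Equality holds for the Poisson integral of the sign of the
normal derivative of the kernel, which is bounded by `1`
(`exists_boundedHarmonicOn_gradConst_le`).

In the complement of a closed convex set, the half-space supported at the point nearest to `x` lies
in the domain and its boundary is as far from `x` as the boundary of the domain, so the half-space
estimate applies.
-/

/-! ### The Laplacian through second derivatives -/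

section Laplacian

variable {E : Type*} [NormedAddCommGroup E] [InnerProductSpace ℝ E]

theorem fderiv_fderiv_nonpos_of_isLocalMax {f : E → ℝ} {x : E} (hf : ContDiffAt ℝ 2 f x)
    (hx : IsLocalMax f x) (v : E) : fderiv ℝ (fderiv ℝ f) x v v ≤ 0 := by
  by_contra! hpos
  set φ : ℝ → ℝ := fun t => f (x + t • v) with hφ
  have hline : ∀ t : ℝ, HasDerivAt (fun t : ℝ => x + t • v) v t := fun t => by
    simpa using ((hasDerivAt_id t).smul_const v).const_add x
  have hcont : Tendsto (fun t : ℝ => x + t • v) (𝓝 0) (𝓝 x) := by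
    simpa using (hline 0).continuousAt.tendsto
  have hd : deriv φ =ᶠ[𝓝 0] fun t => fderiv ℝ f (x + t • v) v := by
    have h1 : ∀ᶠ y in 𝓝 x, DifferentiableAt ℝ f y :=
      (hf.eventually (by simp)).mono fun y hy => hy.differentiableAt (by simp)
    filter_upwards [hcont.eventually h1] with t ht
    exact (ht.hasFDerivAt.comp_hasDerivAt t (hline t)).deriv
  have hdd : deriv (deriv φ) 0 = fderiv ℝ (fderiv ℝ f) x v v := by
    rw [hd.deriv_eq]
    have h2 : DifferentiableAt ℝ (fderiv ℝ f) x :=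
      (hf.fderiv_right (m := 1) (by norm_num)).differentiableAt (by simp)
    have h2' : HasFDerivAt (fderiv ℝ f) (fderiv ℝ (fderiv ℝ f) x) (x + (0 : ℝ) • v) := by
      simpa using h2.hasFDerivAt
    have h3 : HasDerivAt (fun t : ℝ => fderiv ℝ f (x + t • v)) (fderiv ℝ (fderiv ℝ f) x v) 0 :=
      h2'.comp_hasDerivAt (0 : ℝ) (hline 0)
    exact ((ContinuousLinearMap.apply ℝ ℝ v).hasFDerivAt.comp_hasDerivAt (0 : ℝ) h3).deriv
  have hmax : IsLocalMax φ 0 := by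
    have : ∀ᶠ t in 𝓝 (0 : ℝ), f (x + t • v) ≤ f x := hcont.eventually hx
    simpa [IsLocalMax, IsMaxFilter, hφ] using this
  have hφc : ContinuousAt φ 0 :=
    ContinuousAt.comp (g := f) (by simpa using hf.continuousAt) (hline 0).continuousAt
  have hmin : IsLocalMin φ 0 :=
    isLocalMin_of_deriv_deriv_pos (hdd ▸ hpos) hmax.deriv_eq_zero hφc
  -- a point that is both a local minimum and a local maximum makes `φ` locally constant
  have hconst : φ =ᶠ[𝓝 0] fun _ => φ 0 := by
    filter_upwards [hmax, hmin] with t h1 h2 using le_antisymm h1 h2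
  have : deriv (deriv φ) 0 = 0 := by
    rw [hconst.deriv.deriv_eq]; simp
  linarith

variable [FiniteDimensional ℝ E]

theorem laplacian_eq_sum_fderiv_fderiv {ι : Type*} [Fintype ι] (b : OrthonormalBasis ι ℝ E)
    (f : E → ℝ) (x : E) :
    Laplacian.laplacian f x = ∑ i, fderiv ℝ (fderiv ℝ f) x (b i) (b i) := by
  rw [laplacian_eq_iteratedFDeriv_orthonormalBasis f b]
  simp [iteratedFDeriv_two_apply]

theorem laplacian_eq_sum_of_hasFDerivAt {ι : Type*} [Fintype ι] (b : OrthonormalBasis ι ℝ E)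
    {f : E → ℝ} {f' : E → E →L[ℝ] ℝ} {f'' : E →L[ℝ] E →L[ℝ] ℝ} {x : E}
    (h : ∀ᶠ y in 𝓝 x, HasFDerivAt f (f' y) y) (h' : HasFDerivAt f' f'' x) :
    Laplacian.laplacian f x = ∑ i, f'' (b i) (b i) := by
  have : fderiv ℝ f =ᶠ[𝓝 x] f' := h.mono fun y hy => hy.fderiv
  rw [laplacian_eq_sum_fderiv_fderiv b, this.fderiv_eq, h'.fderiv]

theorem laplacian_nonpos_of_isLocalMax {f : E → ℝ} {x : E} (hf : ContDiffAt ℝ 2 f x)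
    (hx : IsLocalMax f x) : Laplacian.laplacian f x ≤ 0 := by
  rw [laplacian_eq_sum_fderiv_fderiv (stdOrthonormalBasis ℝ E)]
  exact Finset.sum_nonpos fun i _ => fderiv_fderiv_nonpos_of_isLocalMax hf hx _

/-- Harmonicity is invariant under rigid motions of the variable. -/
theorem HarmonicAt.comp_affineIsometry {f : E → ℝ} (p : E) (T : E ≃ₗᵢ[ℝ] E) {x : E}
    (hf : HarmonicAt f (p + T x)) : HarmonicAt (fun y => f (p + T y)) x := by
  have hT : ∀ y, HasFDerivAt (fun y => p + T y) (T.toContinuousLinearEquiv : E →L[ℝ] E) y :=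
    fun y => (T.toContinuousLinearEquiv.hasFDerivAt).const_add p
  have hcont : Tendsto (fun y => p + T y) (𝓝 x) (𝓝 (p + T x)) := (hT x).continuousAt.tendsto
  refine ⟨hf.1.comp x (contDiff_const.add T.contDiff).contDiffAt, ?_⟩
  filter_upwards [hcont.eventually hf.eventually] with y hy
  have hc : Tendsto (fun y => p + T y) (𝓝 y) (𝓝 (p + T y)) := (hT y).continuousAt.tendsto
  set L : E →L[ℝ] E := (T.toContinuousLinearEquiv : E →L[ℝ] E) with hL
  have h1 : ∀ᶠ z in 𝓝 y, HasFDerivAt (fun y => f (p + T y))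
      ((fderiv ℝ f (p + T z)).comp L) z := by
    have : ∀ᶠ w in 𝓝 (p + T y), DifferentiableAt ℝ f w :=
      (hy.1.eventually (by simp)).mono fun y hy => hy.differentiableAt (by simp)
    filter_upwards [hc.eventually this] with z hz
    exact hz.hasFDerivAt.comp z (hT z)
  have h2 : DifferentiableAt ℝ (fderiv ℝ f) (p + T y) :=
    (hy.1.fderiv_right (m := 1) (by norm_num)).differentiableAt (by simp)
  have h3 := (h2.hasFDerivAt.comp y (hT y)).clm_comp (hasFDerivAt_const L y)
  rw [laplacian_eq_sum_of_hasFDerivAt (stdOrthonormalBasis ℝ E) h1 h3]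
  have h4 := laplacian_eq_sum_fderiv_fderiv ((stdOrthonormalBasis ℝ E).map T) f (p + T y)
  rw [hy.2.self_of_nhds] at h4
  simp at h4 ⊢
  rw [h4]
  simp [hL]

end Laplacian

/-! ### A Phragmén–Lindelöf principle in the half-space -/

/-- The unit normal of the boundary hyperplane of the upper half-space. -/
noncomputable def normalVec (m : ℕ) : EuclideanSpace ℝ (Fin (m + 1)) :=
  EuclideanSpace.single (Fin.last m) 1

theorem norm_normalVec (m : ℕ) : ‖normalVec m‖ = 1 := by simp [normalVec]

theorem inner_normalVec {m : ℕ} (x : EuclideanSpace ℝ (Fin (m + 1))) :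
    inner ℝ (normalVec m) x = x (Fin.last m) := by
  simp [normalVec, EuclideanSpace.inner_single_left]

theorem isOpen_upperHalfSpace (m : ℕ) : IsOpen (upperHalfSpace m) :=
  isOpen_lt continuous_const (EuclideanSpace.proj (𝕜 := ℝ) (Fin.last m)).continuous

/-- The inner product as a continuous bilinear map, linear in both variables. -/
noncomputable def innerCLM {E : Type*} [NormedAddCommGroup E] [InnerProductSpace ℝ E] :
    E →L[ℝ] E →L[ℝ] ℝ :=
  LinearMap.mkContinuous₂ (innerₗ E) 1 fun x y => by simpa using abs_real_inner_le_norm x y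

theorem sum_inner_mul_inner_basis {E ι : Type*} [NormedAddCommGroup E] [InnerProductSpace ℝ E]
    [Fintype ι] (b : OrthonormalBasis ι ℝ E) (x y : E) :
    ∑ i, inner ℝ x (b i) * inner ℝ y (b i) = inner ℝ x y := by
  rw [← b.sum_inner_mul_inner x y]
  exact Finset.sum_congr rfl fun i _ => by rw [real_inner_comm y]

/-- The quadratic barrier `c (‖x‖² + (m+2) t (R - t))` of the half-ball of radius `R` in
`ℝ^{m+1}`, where `t` is the last coordinate of `x`. For `c = M / R²` it is nonnegative on
the half-ball and at least `M` on the spherical part of its boundary; the factor `m + 2`, one more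
than the dimension, makes it strictly superharmonic. At a fixed point it tends to `0` as
`R → ∞`. -/
noncomputable def barrier (m : ℕ) (c R : ℝ) (x : EuclideanSpace ℝ (Fin (m + 1))) : ℝ :=
  c * (‖x‖ ^ 2 + (m + 2) * (inner ℝ (normalVec m) x * (R - inner ℝ (normalVec m) x)))

theorem contDiff_barrier (m : ℕ) (c R : ℝ) : ContDiff ℝ 2 (barrier m c R) := by
  have : ContDiff ℝ 2 fun x : EuclideanSpace ℝ (Fin (m + 1)) => ‖x‖ ^ 2 := contDiff_norm_sq ℝ
  have h2 : ContDiff ℝ 2 fun x : EuclideanSpace ℝ (Fin (m + 1)) => inner ℝ (normalVec m) x :=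
    (innerSL ℝ (normalVec m)).contDiff
  unfold barrier
  fun_prop

theorem laplacian_barrier {m : ℕ} (c R : ℝ) (x : EuclideanSpace ℝ (Fin (m + 1))) :
    Laplacian.laplacian (barrier m c R) x = -2 * c := by
  set e := normalVec m with he
  have hi : ∀ y, HasFDerivAt (fun y => inner ℝ e y) (innerSL ℝ e) y := fun y =>
    (innerSL ℝ e).hasFDerivAt
  have h1 : ∀ y, HasFDerivAt (barrier m c R)
      ((2 * c) • innerCLM y + (c * (m + 2) * (R - 2 * inner ℝ e y)) • innerCLM e) y := by
    intro y
    have hn : HasFDerivAt (fun x : EuclideanSpace ℝ (Fin (m + 1)) => ‖x‖ ^ 2)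
      (2 • innerSL ℝ y) y := (hasStrictFDerivAt_norm_sq y).hasFDerivAt
    refine ((hn.add (((hi y).mul ((hi y).const_sub R)).const_mul ((m : ℝ) + 2))).const_mul
      c).congr_fderiv ?_
    ext v
    simp [innerCLM]
    ring
  have h2 : HasFDerivAt (fun y => (2 * c) • innerCLM y +
      (c * (m + 2) * (R - 2 * inner ℝ e y)) • innerCLM e)
      ((2 * c) • innerCLM + (-(2 * (c * (m + 2))) • innerCLM e).smulRight (innerCLM e)) x := by
    have h3 : HasFDerivAt (fun y => c * (m + 2) * (R - 2 * inner ℝ e y))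
        (-(2 * (c * (m + 2))) • innerCLM e) x := by
      refine ((((hi x).const_mul 2).const_sub R).const_mul (c * (m + 2))).congr_fderiv ?_
      ext v
      simp [innerCLM]
      ring
    exact (innerCLM.hasFDerivAt.fun_const_smul (2 * c)).add (h3.smul_const (innerCLM e))
  rw [laplacian_eq_sum_of_hasFDerivAt (EuclideanSpace.basisFun _ ℝ) (Eventually.of_forall h1) h2]
  have h3 := sum_inner_mul_inner_basis (EuclideanSpace.basisFun (Fin (m + 1)) ℝ) e e
  rw [real_inner_self_eq_norm_sq, norm_normalVec] at h3
  simp [innerCLM, Finset.sum_add_distrib]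
  simp only [mul_assoc, ← Finset.mul_sum]
  simp at h3
  rw [h3]
  ring

/-- A harmonic function in the half-space that is bounded above, continuous up to the boundary
hyperplane and nonpositive there is nonpositive. -/
theorem nonpos_of_harmonic_of_boundary_nonpos {m : ℕ} {f : EuclideanSpace ℝ (Fin (m + 1)) → ℝ}
    {M : ℝ} (hc : ContinuousOn f {x | 0 ≤ x (Fin.last m)})
    (hh : HarmonicOnNhd f (upperHalfSpace m)) (hb : ∀ x ∈ upperHalfSpace m, f x ≤ M)
    (h0 : ∀ x, x (Fin.last m) = 0 → f x ≤ 0) {x : EuclideanSpace ℝ (Fin (m + 1))}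
    (hx : x ∈ upperHalfSpace m) : f x ≤ 0 := by
  wlog hM : 0 < M generalizing M
  · exact this (M := 1) (fun y hy => (hb y hy).trans (by linarith)) one_pos
  set e := normalVec m with he
  have hproj : Continuous fun x : EuclideanSpace ℝ (Fin (m + 1)) => x (Fin.last m) :=
    (EuclideanSpace.proj (𝕜 := ℝ) (Fin.last m)).continuous
  have key : ∀ R : ℝ, ‖x‖ < R → f x ≤
      M / R ^ 2 * (‖x‖ ^ 2 + (m + 2) * (inner ℝ e x * (R - inner ℝ e x))) := by
    intro R hR
    have hRpos : 0 < R := (norm_nonneg x).trans_lt hR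
    set b := barrier m (M / R ^ 2) R with hbdef
    set D := Metric.closedBall (0 : EuclideanSpace ℝ (Fin (m + 1))) R ∩ {x | 0 ≤ x (Fin.last m)}
    have hD : IsCompact D :=
      (isCompact_closedBall _ _).inter_right (isClosed_le continuous_const hproj)
    have hxD : x ∈ D := ⟨by simpa using hR.le, show 0 ≤ x (Fin.last m) from le_of_lt hx⟩
    have hbc : Continuous b := (contDiff_barrier m _ R).continuous
    obtain ⟨y, hyD, hy⟩ := hD.exists_isMaxOn ⟨x, hxD⟩
      (f := fun y => f y - b y) ((hc.mono Set.inter_subset_right).sub hbc.continuousOn)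
    have hle : f x - b x ≤ f y - b y := hy hxD
    suffices f y - b y ≤ 0 by
      have : f x ≤ b x := by linarith
      exact this
    have hyR : ‖y‖ ≤ R := by simpa using hyD.1
    have hy0 : 0 ≤ inner ℝ e y := by rw [inner_normalVec]; exact hyD.2
    have hyle : inner ℝ e y ≤ ‖y‖ := by
      simpa [he, norm_normalVec] using real_inner_le_norm e y
    have hb0 : 0 ≤ b y := by
      rw [hbdef, barrier, ← he]
      have : 0 ≤ R - inner ℝ e y := by linarith
      positivity
    rcases hy0.eq_or_lt with h | h
    · have := h0 y (by rw [← inner_normalVec]; exact h.symm)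
      linarith
    have hyH : y ∈ upperHalfSpace m := by
      change 0 < y (Fin.last m)
      rw [← inner_normalVec]; exact h
    rcases hyR.eq_or_lt with h' | h'
    · have : M ≤ b y := by
        have h1 : M = M / R ^ 2 * R ^ 2 := by field_simp
        have h2 : 0 ≤ (m + 2 : ℝ) * (inner ℝ e y * (R - inner ℝ e y)) := by
          have : 0 ≤ R - inner ℝ e y := by linarith
          positivity
        calc M = M / R ^ 2 * R ^ 2 := h1
          _ ≤ b y := by
            rw [hbdef, barrier, ← he]
            simp only [h']
            gcongr
            linarith
      have := hb y hyH
      linarith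
    -- an interior maximum contradicts the strict superharmonicity of the barrier
    exfalso
    have hmax : IsLocalMax (fun y => f y - b y) y := by
      refine hy.isLocalMax ?_
      refine Filter.inter_mem (Metric.closedBall_mem_nhds_of_mem (by simpa using h')) ?_
      exact Filter.mem_of_superset ((isOpen_upperHalfSpace m).mem_nhds hyH) fun z hz =>
        show 0 ≤ z (Fin.last m) from le_of_lt hz
    have h1 := laplacian_nonpos_of_isLocalMax
      ((hh y hyH).1.sub (contDiff_barrier m _ R).contDiffAt) hmax
    have h2 := (hh y hyH).1.laplacian_sub (contDiff_barrier m (M / R ^ 2) R).contDiffAt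
    have h3 : Laplacian.laplacian f y = 0 := (hh y hyH).2.self_of_nhds
    rw [laplacian_barrier, h3] at h2
    have h4 : 0 - -2 * (M / R ^ 2) ≤ 0 := h2 ▸ h1
    have : 0 < M / R ^ 2 := by positivity
    linarith
  have hlim : Tendsto (fun R : ℝ => M / R ^ 2 *
      (‖x‖ ^ 2 + (m + 2) * (inner ℝ e x * (R - inner ℝ e x)))) atTop (𝓝 0) := by
    have h1 : Tendsto (fun R : ℝ => R⁻¹) atTop (𝓝 0) := tendsto_inv_atTop_zero
    have h2 : Tendsto (fun R : ℝ => M * (R⁻¹ ^ 2 * (‖x‖ ^ 2 - (m + 2) * inner ℝ e x ^ 2) +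
        R⁻¹ * ((m + 2) * inner ℝ e x))) atTop
        (𝓝 (M * (0 ^ 2 * (‖x‖ ^ 2 - (m + 2) * inner ℝ e x ^ 2) +
        0 * ((m + 2) * inner ℝ e x)))) :=
      (((h1.pow 2).mul_const _).add (h1.mul_const _)).const_mul _
    simp only [ne_eq, OfNat.ofNat_ne_zero, not_false_eq_true, zero_pow, zero_mul, add_zero,
      mul_zero] at h2
    refine h2.congr' ?_
    filter_upwards [eventually_gt_atTop 0] with R hR
    field_simp
    ring
  exact ge_of_tendsto hlim ((eventually_gt_atTop ‖x‖).mono key)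

/-! ### Coordinates on the half-space -/

section Coordinates

variable {m : ℕ}

@[simp] theorem halfSpacePoint_last (y : EuclideanSpace ℝ (Fin m)) (t : ℝ) :
    halfSpacePoint y t (Fin.last m) = t := by
  simp [halfSpacePoint]

@[simp] theorem halfSpacePoint_castSucc (y : EuclideanSpace ℝ (Fin m)) (t : ℝ) (i : Fin m) :
    halfSpacePoint y t i.castSucc = y i := by
  simp [halfSpacePoint]

theorem euclideanSpace_succ_ext {x y : EuclideanSpace ℝ (Fin (m + 1))}
    (h : ∀ i : Fin m, x i.castSucc = y i.castSucc) (h' : x (Fin.last m) = y (Fin.last m)) :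
    x = y := by
  ext i
  exact Fin.lastCases h' h i

theorem norm_sq_halfSpacePoint (y : EuclideanSpace ℝ (Fin m)) (t : ℝ) :
    ‖halfSpacePoint y t‖ ^ 2 = ‖y‖ ^ 2 + t ^ 2 := by
  simp [EuclideanSpace.norm_sq_eq, Fin.sum_univ_castSucc]

theorem halfSpacePoint_sub (y z : EuclideanSpace ℝ (Fin m)) (s t : ℝ) :
    halfSpacePoint y t - halfSpacePoint z s = halfSpacePoint (y - z) (t - s) :=
  euclideanSpace_succ_ext (by simp) (by simp)

theorem halfSpacePoint_add (y z : EuclideanSpace ℝ (Fin m)) (s t : ℝ) :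
    halfSpacePoint y t + halfSpacePoint z s = halfSpacePoint (y + z) (t + s) :=
  euclideanSpace_succ_ext (by simp) (by simp)

theorem smul_halfSpacePoint (c : ℝ) (y : EuclideanSpace ℝ (Fin m)) (t : ℝ) :
    c • halfSpacePoint y t = halfSpacePoint (c • y) (c * t) :=
  euclideanSpace_succ_ext (by simp) (by simp)

theorem halfSpacePoint_zero_eq (t : ℝ) :
    halfSpacePoint (0 : EuclideanSpace ℝ (Fin m)) t = t • normalVec m :=
  euclideanSpace_succ_ext (by simp [normalVec]) (by simp [normalVec])

/-- The tangential part of a point of `ℝ^{m+1}`. -/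
def tangentialPart (x : EuclideanSpace ℝ (Fin (m + 1))) : EuclideanSpace ℝ (Fin m) :=
  WithLp.toLp 2 fun i => x i.castSucc

theorem halfSpacePoint_tangentialPart (x : EuclideanSpace ℝ (Fin (m + 1))) :
    halfSpacePoint (tangentialPart x) (x (Fin.last m)) = x :=
  euclideanSpace_succ_ext (by simp [tangentialPart]) (by simp)

@[simp] theorem tangentialPart_halfSpacePoint (y : EuclideanSpace ℝ (Fin m)) (t : ℝ) :
    tangentialPart (halfSpacePoint y t) = y := by
  ext i
  simp [tangentialPart]

theorem continuous_coord_last : Continuous fun x : EuclideanSpace ℝ (Fin (m + 1)) =>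
    x (Fin.last m) :=
  (EuclideanSpace.proj (𝕜 := ℝ) (Fin.last m)).continuous

theorem continuous_tangentialPart : Continuous (tangentialPart (m := m)) :=
  (PiLp.continuous_toLp 2 _).comp
    (continuous_pi fun i => (EuclideanSpace.proj (𝕜 := ℝ) i.castSucc).continuous)

theorem continuous_halfSpacePoint :
    Continuous fun p : EuclideanSpace ℝ (Fin m) × ℝ => halfSpacePoint p.1 p.2 := by
  refine (PiLp.continuous_toLp 2 _).comp (continuous_pi fun i => ?_)
  refine Fin.lastCases ?_ (fun j => ?_) i
  · simpa using continuous_snd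
  · simpa [Function.comp_def] using
      (EuclideanSpace.proj (𝕜 := ℝ) j).continuous.comp
        (continuous_fst (X := EuclideanSpace ℝ (Fin m)) (Y := ℝ))

theorem continuous_halfSpacePoint_left (t : ℝ) :
    Continuous fun y : EuclideanSpace ℝ (Fin m) => halfSpacePoint y t :=
  continuous_halfSpacePoint.comp (continuous_id.prodMk continuous_const)

theorem measurePreserving_halfSpacePoint :
    MeasurePreserving fun p : EuclideanSpace ℝ (Fin m) × ℝ => halfSpacePoint p.1 p.2 := by
  have h1 := (volume_preserving_piFinSuccAbove (fun _ : Fin (m + 1) => ℝ) (Fin.last m)).symm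
  have h2 : MeasurePreserving (fun p : EuclideanSpace ℝ (Fin m) × ℝ => (p.2, p.1.ofLp)) :=
    ((MeasurePreserving.id volume).prod (PiLp.volume_preserving_ofLp (Fin m))).comp
      Measure.measurePreserving_swap
  have h3 := ((PiLp.volume_preserving_toLp (Fin (m + 1))).comp h1).comp h2
  convert h3 using 1
  funext p
  refine euclideanSpace_succ_ext (fun i => ?_) ?_ <;>
    simp [MeasurableEquiv.piFinSuccAbove, Fin.insertNthEquiv]

end Coordinates

/-! ### The Poisson kernel of the half-space -/

section Homogeneous

variable {E F : Type*} [NormedAddCommGroup E] [NormedSpace ℝ E]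
  [NormedAddCommGroup F] [NormedSpace ℝ F]

theorem fderiv_smul_of_homogeneous {Φ : E → F} {k : ℝ}
    (h : ∀ c : ℝ, 0 < c → ∀ x, Φ (c • x) = c ^ k • Φ x) (c : ℝ) (hc : 0 < c) (x : E) :
    fderiv ℝ Φ (c • x) = c ^ (k - 1) • fderiv ℝ Φ x := by
  have h1 : fderiv ℝ (fun y => Φ (c • y)) x = c • fderiv ℝ Φ (c • x) := fderiv_comp_smul c
  have h2 : fderiv ℝ (fun y => Φ (c • y)) x = c ^ k • fderiv ℝ Φ x := by
    rw [funext (h c hc)]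
    exact congrFun (fderiv_const_smul_field (𝕜 := ℝ) (f := Φ) (c ^ k)) x
  rw [Real.rpow_sub_one hc.ne', div_eq_inv_mul, mul_smul, ← h2, h1, inv_smul_smul₀ hc.ne']

theorem exists_norm_le_of_homogeneous [FiniteDimensional ℝ E] {Φ : E → F} {k : ℝ}
    (hc : ContinuousOn Φ {0}ᶜ) (h : ∀ c : ℝ, 0 < c → ∀ x, Φ (c • x) = c ^ k • Φ x) :
    ∃ C, 0 ≤ C ∧ ∀ x, x ≠ 0 → ‖Φ x‖ ≤ C * ‖x‖ ^ k := by
  have : ProperSpace E := FiniteDimensional.proper_real E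
  obtain ⟨C, hC⟩ := (isCompact_sphere (0 : E) 1).exists_bound_of_continuousOn
    (hc.mono fun x hx => by
      rintro rfl
      simp at hx)
  refine ⟨max C 0, le_max_right _ _, fun x hx => ?_⟩
  have hx' : 0 < ‖x‖ := norm_pos_iff.2 hx
  have h1 := h ‖x‖ hx' (‖x‖⁻¹ • x)
  rw [smul_inv_smul₀ hx'.ne'] at h1
  rw [h1, norm_smul, Real.norm_of_nonneg (by positivity), mul_comm]
  gcongr
  refine (hC _ ?_).trans (le_max_left _ _)
  simp [norm_smul, hx'.ne']

end Homogeneous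

section Kernel

variable (m : ℕ)

/-- The Poisson kernel `x_n / ‖x‖^n` of the upper half-space of `ℝⁿ`, `n = m + 1`, up to a
normalizing constant. -/
noncomputable def poissonCore (x : EuclideanSpace ℝ (Fin (m + 1))) : ℝ :=
  inner ℝ (normalVec m) x * (‖x‖ ^ 2) ^ (-((m + 1 : ℝ) / 2))

theorem poissonCore_smul (c : ℝ) (hc : 0 < c) (x : EuclideanSpace ℝ (Fin (m + 1))) :
    poissonCore m (c • x) = c ^ (-(m : ℝ)) • poissonCore m x := by
  have h1 : (c ^ 2 : ℝ) ^ (-((m + 1 : ℝ) / 2)) = c ^ (-(m : ℝ)) * c⁻¹ := by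
    rw [← Real.rpow_natCast c 2, ← Real.rpow_mul hc.le, ← div_eq_mul_inv,
      ← Real.rpow_sub_one hc.ne']
    congr 1
    push_cast
    ring
  rw [poissonCore, poissonCore, norm_smul, Real.norm_of_nonneg hc.le, mul_pow,
    Real.mul_rpow (by positivity) (by positivity), h1, inner_smul_right, smul_eq_mul]
  field_simp

variable {m}

theorem contDiffAt_poissonCore {x : EuclideanSpace ℝ (Fin (m + 1))} (hx : x ≠ 0) :
    ContDiffAt ℝ 3 (poissonCore m) x := by
  refine ContDiffAt.mul (innerSL ℝ (normalVec m)).contDiff.contDiffAt ?_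
  exact (contDiff_norm_sq ℝ).contDiffAt.rpow_const_of_ne (by simpa using hx)

theorem contDiffAt_fderiv_poissonCore {x : EuclideanSpace ℝ (Fin (m + 1))} (hx : x ≠ 0) :
    ContDiffAt ℝ 2 (fderiv ℝ (poissonCore m)) x :=
  (contDiffAt_poissonCore hx).fderiv_right (by norm_num)

theorem contDiffAt_fderiv_fderiv_poissonCore {x : EuclideanSpace ℝ (Fin (m + 1))} (hx : x ≠ 0) :
    ContDiffAt ℝ 1 (fderiv ℝ (fderiv ℝ (poissonCore m))) x :=
  (contDiffAt_fderiv_poissonCore hx).fderiv_right (by norm_num)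

theorem hasFDerivAt_norm_sq_rpow {x : EuclideanSpace ℝ (Fin (m + 1))} (hx : x ≠ 0) (p : ℝ) :
    HasFDerivAt (fun y : EuclideanSpace ℝ (Fin (m + 1)) => (‖y‖ ^ 2) ^ p)
      ((2 * p * (‖x‖ ^ 2) ^ (p - 1)) • innerCLM x) x := by
  have hn : HasFDerivAt (fun x : EuclideanSpace ℝ (Fin (m + 1)) => ‖x‖ ^ 2)
      (2 • innerSL ℝ x) x := (hasStrictFDerivAt_norm_sq x).hasFDerivAt
  refine (hn.rpow_const (p := p) (Or.inl (by simpa using hx))).congr_fderiv ?_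
  ext v
  simp [innerCLM]
  ring

theorem hasFDerivAt_inner_mul_norm_sq_rpow {x : EuclideanSpace ℝ (Fin (m + 1))} (hx : x ≠ 0)
    (p : ℝ) :
    HasFDerivAt (fun y : EuclideanSpace ℝ (Fin (m + 1)) =>
        inner ℝ (normalVec m) y * (‖y‖ ^ 2) ^ p)
      ((‖x‖ ^ 2) ^ p • innerCLM (normalVec m) +
        (2 * p * inner ℝ (normalVec m) x * (‖x‖ ^ 2) ^ (p - 1)) • innerCLM x) x := by
  have hi : HasFDerivAt (fun y => inner ℝ (normalVec m) y) (innerSL ℝ (normalVec m)) x :=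
    (innerSL ℝ (normalVec m)).hasFDerivAt
  refine (hi.mul (hasFDerivAt_norm_sq_rpow hx p)).congr_fderiv ?_
  ext v
  simp [innerCLM]
  ring

theorem fderiv_poissonCore_apply {x : EuclideanSpace ℝ (Fin (m + 1))} (hx : x ≠ 0)
    (v : EuclideanSpace ℝ (Fin (m + 1))) :
    fderiv ℝ (poissonCore m) x v = (‖x‖ ^ 2) ^ (-((m + 1 : ℝ) / 2)) *
      (inner ℝ (normalVec m) v -
        (m + 1) * inner ℝ (normalVec m) x * inner ℝ x v / ‖x‖ ^ 2) := by
  have hx' : ‖x‖ ^ 2 ≠ 0 := by simpa using hx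
  have h : fderiv ℝ (poissonCore m) x = _ :=
    (hasFDerivAt_inner_mul_norm_sq_rpow hx (-((m + 1 : ℝ) / 2))).fderiv
  rw [h, Real.rpow_sub_one hx']
  simp [innerCLM]
  field_simp
  ring

theorem laplacian_poissonCore {x : EuclideanSpace ℝ (Fin (m + 1))} (hx : x ≠ 0) :
    Laplacian.laplacian (poissonCore m) x = 0 := by
  set a : ℝ := (m + 1 : ℝ) / 2 with ha
  set e := normalVec m with he
  have h1 : ∀ᶠ y in 𝓝 x, HasFDerivAt (poissonCore m)
      ((‖y‖ ^ 2) ^ (-a) • innerCLM e +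
        (2 * -a * inner ℝ e y * (‖y‖ ^ 2) ^ (-a - 1)) • innerCLM y) y :=
    (isOpen_ne.eventually_mem hx).mono fun y hy => hasFDerivAt_inner_mul_norm_sq_rpow hy (-a)
  have h2 := ((hasFDerivAt_inner_mul_norm_sq_rpow hx (-a - 1)).const_mul (2 * -a)).fun_smul
    (innerCLM (E := EuclideanSpace ℝ (Fin (m + 1)))).hasFDerivAt
  simp only [← mul_assoc] at h2
  have h3 := ((hasFDerivAt_norm_sq_rpow hx (-a)).smul_const (innerCLM e)).fun_add h2
  rw [laplacian_eq_sum_of_hasFDerivAt (EuclideanSpace.basisFun _ ℝ) h1 h3]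
  have hx' : ‖x‖ ^ 2 ≠ 0 := by simpa using hx
  have h4 := sum_inner_mul_inner_basis (EuclideanSpace.basisFun (Fin (m + 1)) ℝ) e x
  have h5 := sum_inner_mul_inner_basis (EuclideanSpace.basisFun (Fin (m + 1)) ℝ) x x
  rw [real_inner_self_eq_norm_sq] at h5
  have h6 : ∀ i, innerCLM (EuclideanSpace.basisFun (Fin (m + 1)) ℝ i)
      (EuclideanSpace.basisFun (Fin (m + 1)) ℝ i) = 1 := fun i => by simp [innerCLM]
  have h7 : ∀ y z : EuclideanSpace ℝ (Fin (m + 1)), innerCLM y z = inner ℝ y z := fun y z => by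
    simp [innerCLM]
  simp only [add_apply, smul_apply,
    ContinuousLinearMap.smulRight_apply, h6, smul_eq_mul]
  simp only [h7]
  set b := EuclideanSpace.basisFun (Fin (m + 1)) ℝ
  have h8 : ∀ i, 2 * -a * (‖x‖ ^ 2) ^ (-a - 1) * inner ℝ x (b i) * inner ℝ e (b i) +
      (2 * -a * inner ℝ e x * (‖x‖ ^ 2) ^ (-a - 1) * 1 + 2 * -a *
        ((‖x‖ ^ 2) ^ (-a - 1) * inner ℝ e (b i) +
          2 * (-a - 1) * inner ℝ e x * (‖x‖ ^ 2) ^ (-a - 1 - 1) * inner ℝ x (b i)) *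
            inner ℝ x (b i)) =
      (-4 * a * (‖x‖ ^ 2) ^ (-a - 1)) * (inner ℝ e (b i) * inner ℝ x (b i)) +
      (-2 * a * inner ℝ e x * (‖x‖ ^ 2) ^ (-a - 1)) +
      (4 * a * (a + 1) * inner ℝ e x * (‖x‖ ^ 2) ^ (-a - 1 - 1)) *
        (inner ℝ x (b i) * inner ℝ x (b i)) := fun i => by ring
  trans ∑ i, ((-4 * a * (‖x‖ ^ 2) ^ (-a - 1)) * (inner ℝ e (b i) * inner ℝ x (b i)) +
      (-2 * a * inner ℝ e x * (‖x‖ ^ 2) ^ (-a - 1)) +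
      (4 * a * (a + 1) * inner ℝ e x * (‖x‖ ^ 2) ^ (-a - 1 - 1)) *
        (inner ℝ x (b i) * inner ℝ x (b i)))
  · refine Finset.sum_congr rfl fun i _ => ?_
    rw [← h8]
  rw [Finset.sum_add_distrib, Finset.sum_add_distrib, Finset.sum_const, ← Finset.mul_sum,
    ← Finset.mul_sum, h4, h5, Real.rpow_sub_one hx' (-a - 1)]
  simp
  field_simp
  rw [ha]
  ring

end Kernel

/-! ### Kernels with the decay of the Poisson kernel -/

section Decay

variable {m : ℕ} {F : Type*} [NormedAddCommGroup F]

/-- Decay of order `‖x‖^{-n}`, `n = m + 1`, in horizontal strips of the upper half-space: this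
makes `z ↦ Φ (x - (z, 0))` integrable on `ℝ^m`, locally uniformly in `x`. -/
def HasPoissonDecay (Φ : EuclideanSpace ℝ (Fin (m + 1)) → F) : Prop :=
  ∀ δ T : ℝ, 0 < δ → ∃ C, 0 ≤ C ∧ ∀ x : EuclideanSpace ℝ (Fin (m + 1)), δ ≤ x (Fin.last m) →
    x (Fin.last m) ≤ T → ‖Φ x‖ ≤ C * ‖x‖ ^ (-(m + 1 : ℝ))

theorem ne_zero_of_mem_upperHalfSpace {x : EuclideanSpace ℝ (Fin (m + 1))}
    (hx : x ∈ upperHalfSpace m) : x ≠ 0 := by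
  rintro rfl
  simp [upperHalfSpace] at hx

theorem coord_last_le_norm (x : EuclideanSpace ℝ (Fin (m + 1))) : |x (Fin.last m)| ≤ ‖x‖ :=
  PiLp.norm_apply_le x (Fin.last m)

theorem hasPoissonDecay_poissonCore : HasPoissonDecay (poissonCore m) := by
  intro δ T hδ
  refine ⟨max T 0, le_max_right _ _, fun x h1 h2 => ?_⟩
  have h3 : ((‖x‖ ^ 2) ^ (-((m + 1 : ℝ) / 2)) : ℝ) = ‖x‖ ^ (-(m + 1 : ℝ)) := by
    rw [← Real.rpow_natCast ‖x‖ 2, ← Real.rpow_mul (norm_nonneg x)]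
    congr 1
    push_cast
    ring
  rw [poissonCore, inner_normalVec, h3, norm_mul, Real.norm_of_nonneg (by linarith),
    Real.norm_of_nonneg (by positivity)]
  gcongr
  exact h2.trans (le_max_left _ _)

theorem hasPoissonDecay_fderiv_poissonCore : HasPoissonDecay (fderiv ℝ (poissonCore m)) := by
  intro δ T hδ
  obtain ⟨C, hC, h⟩ := exists_norm_le_of_homogeneous
    (fun x hx => (contDiffAt_fderiv_poissonCore hx).continuousAt.continuousWithinAt)
    (fderiv_smul_of_homogeneous (poissonCore_smul m))
  refine ⟨C, hC, fun x h1 h2 => ?_⟩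
  have := h x (ne_zero_of_mem_upperHalfSpace (hδ.trans_le h1))
  rwa [show -(m : ℝ) - 1 = -(m + 1 : ℝ) by ring] at this

theorem hasPoissonDecay_fderiv_fderiv_poissonCore :
    HasPoissonDecay (fderiv ℝ (fderiv ℝ (poissonCore m))) := by
  intro δ T hδ
  obtain ⟨C, hC, h⟩ := exists_norm_le_of_homogeneous
    (fun x hx => (contDiffAt_fderiv_fderiv_poissonCore hx).continuousAt.continuousWithinAt)
    (fderiv_smul_of_homogeneous (fderiv_smul_of_homogeneous (poissonCore_smul m)))
  refine ⟨C * δ⁻¹, by positivity, fun x h1 h2 => ?_⟩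
  have hδx : δ ≤ ‖x‖ := h1.trans ((le_abs_self _).trans (coord_last_le_norm x))
  have hx : 0 < ‖x‖ := hδ.trans_le hδx
  refine (h x (norm_pos_iff.1 hx)).trans ?_
  rw [show -(m : ℝ) - 1 - 1 = -(m + 1 : ℝ) - 1 by ring, Real.rpow_sub_one hx.ne', mul_assoc,
    div_eq_inv_mul]
  gcongr

end Decay

/-! ### Integrals of decaying kernels over the boundary hyperplane -/

section KernelIntegral

variable {m : ℕ} {F : Type*} [NormedAddCommGroup F]

theorem integrable_poissonWeight (m : ℕ) :
    Integrable fun z : EuclideanSpace ℝ (Fin m) => (1 + ‖z‖ ^ 2) ^ (-(m + 1 : ℝ) / 2) :=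
  integrable_rpow_neg_one_add_norm_sq (by simp)

theorem sub_halfSpacePoint_zero_mem {x : EuclideanSpace ℝ (Fin (m + 1))}
    (hx : x ∈ upperHalfSpace m) (z : EuclideanSpace ℝ (Fin m)) :
    x - halfSpacePoint z 0 ∈ upperHalfSpace m := by
  simpa [upperHalfSpace] using hx

theorem HasPoissonDecay.exists_bound {Φ : EuclideanSpace ℝ (Fin (m + 1)) → F}
    (hΦ : HasPoissonDecay Φ) {x₀ : EuclideanSpace ℝ (Fin (m + 1))} (hx₀ : x₀ ∈ upperHalfSpace m) :
    ∃ U ∈ 𝓝 x₀, U ⊆ upperHalfSpace m ∧ ∃ C, 0 ≤ C ∧ ∀ x ∈ U, ∀ z,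
      ‖Φ (x - halfSpacePoint z 0)‖ ≤ C * (1 + ‖z‖ ^ 2) ^ (-(m + 1 : ℝ) / 2) := by
  set t := x₀ (Fin.last m) with ht
  have htpos : 0 < t := hx₀
  obtain ⟨C, hC, h⟩ := hΦ (t / 2) (2 * t) (by positivity)
  have hcoord : ∀ x ∈ Metric.ball x₀ (t / 2), t / 2 ≤ x (Fin.last m) ∧ x (Fin.last m) ≤ 2 * t := by
    intro x hx
    have h1 := coord_last_le_norm (x - x₀)
    rw [mem_ball_iff_norm] at hx
    have h2 := abs_le.1 (h1.trans hx.le)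
    simp only [PiLp.sub_apply] at h2
    constructor <;> linarith [h2.1, h2.2]
  set A := ‖x₀‖ + t / 2
  set B := (1 + A) / (t / 2) + 1
  have hA : 0 ≤ A := by positivity
  have hB : 0 < B := by positivity
  refine ⟨Metric.ball x₀ (t / 2), Metric.ball_mem_nhds _ (by positivity), fun x hx => ?_,
    C * B ^ (m + 1 : ℝ), by positivity, fun x hx z => ?_⟩
  · exact lt_of_lt_of_le (by positivity : 0 < t / 2) (hcoord x hx).1
  have hx1 := hcoord x hx
  have h1 := h (x - halfSpacePoint z 0) (by simpa using hx1.1) (by simpa using hx1.2)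
  refine h1.trans ?_
  rw [mul_assoc]
  gcongr
  set r := ‖x - halfSpacePoint z 0‖ with hr
  have hr1 : t / 2 ≤ r := by
    refine le_trans ?_ ((le_abs_self _).trans (coord_last_le_norm _))
    simpa using hx1.1
  have hr0 : 0 < r := lt_of_lt_of_le (by positivity) hr1
  have hz : ‖z‖ ≤ r + A := by
    have h2 : ‖halfSpacePoint z 0‖ = ‖z‖ := by
      have := norm_sq_halfSpacePoint z 0
      rw [zero_pow two_ne_zero, add_zero] at this
      exact (pow_left_inj₀ (norm_nonneg _) (norm_nonneg _) two_ne_zero).1 this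
    have h3 : ‖halfSpacePoint z 0‖ ≤ ‖x - halfSpacePoint z 0‖ + ‖x‖ := by
      have := norm_sub_le x (x - halfSpacePoint z 0)
      rw [sub_sub_cancel] at this
      linarith
    have h4 : ‖x‖ ≤ A := by
      rw [mem_ball_iff_norm] at hx
      have := norm_le_norm_add_norm_sub' x x₀
      exact this.trans (add_le_add_right hx.le _)
    linarith
  have hBr : 1 + ‖z‖ ≤ B * r := by
    have : (1 + A) ≤ (1 + A) / (t / 2) * r := by
      rw [div_mul_eq_mul_div, le_div_iff₀ (by positivity)]
      gcongr
    calc 1 + ‖z‖ ≤ (1 + A) + r := by linarith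
      _ ≤ (1 + A) / (t / 2) * r + r := by linarith
      _ = B * r := by ring
  have hsq : 1 + ‖z‖ ^ 2 ≤ (B * r) ^ 2 := by
    have := norm_nonneg z
    nlinarith
  have h5 : ((B * r) ^ 2) ^ (-(m + 1 : ℝ) / 2) = B ^ (-(m + 1 : ℝ)) * r ^ (-(m + 1 : ℝ)) := by
    rw [← Real.mul_rpow hB.le hr0.le, ← Real.rpow_natCast (B * r) 2,
      ← Real.rpow_mul (by positivity)]
    congr 1
    push_cast
    ring
  have h6 : ((B * r) ^ 2) ^ (-(m + 1 : ℝ) / 2) ≤ (1 + ‖z‖ ^ 2) ^ (-(m + 1 : ℝ) / 2) :=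
    Real.rpow_le_rpow_of_nonpos (by positivity) hsq (by
      have : (0 : ℝ) ≤ m := Nat.cast_nonneg m
      linarith)
  calc r ^ (-(m + 1 : ℝ))
      = B ^ (m + 1 : ℝ) * (B ^ (-(m + 1 : ℝ)) * r ^ (-(m + 1 : ℝ))) := by
        rw [← mul_assoc, ← Real.rpow_add hB, add_neg_cancel, Real.rpow_zero, one_mul]
    _ ≤ _ := by rw [← h5]; gcongr

variable [NormedSpace ℝ F]

/-- The integral of the kernel `z ↦ Φ (x - (z, 0))` against the density `g` on `ℝ^m`. -/
noncomputable def kernelIntegral (g : EuclideanSpace ℝ (Fin m) → ℝ)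
    (Φ : EuclideanSpace ℝ (Fin (m + 1)) → F) (x : EuclideanSpace ℝ (Fin (m + 1))) : F :=
  ∫ z, g z • Φ (x - halfSpacePoint z 0)

variable {g : EuclideanSpace ℝ (Fin m) → ℝ} {M : ℝ} {Φ : EuclideanSpace ℝ (Fin (m + 1)) → F}

theorem aestronglyMeasurable_kernel (hg : AEStronglyMeasurable g volume)
    (hc : ContinuousOn Φ (upperHalfSpace m)) {x : EuclideanSpace ℝ (Fin (m + 1))}
    (hx : x ∈ upperHalfSpace m) :
    AEStronglyMeasurable (fun z => g z • Φ (x - halfSpacePoint z 0)) volume := by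
  refine hg.smul (Continuous.aestronglyMeasurable ?_)
  exact hc.comp_continuous (continuous_const.sub (continuous_halfSpacePoint_left 0))
    (sub_halfSpacePoint_zero_mem hx)

theorem norm_smul_kernel_le {a b w C : ℝ} {y : F} (ha : |a| ≤ M) (hy : ‖y‖ ≤ C * w)
    (hb : b = M * (C * w)) : ‖a • y‖ ≤ b := by
  rw [norm_smul, hb, Real.norm_eq_abs]
  have := norm_nonneg y
  gcongr
  exact (abs_nonneg a).trans ha

theorem integrable_kernel (hg : AEStronglyMeasurable g volume) (hM : ∀ z, |g z| ≤ M)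
    (hc : ContinuousOn Φ (upperHalfSpace m)) (hΦ : HasPoissonDecay Φ)
    {x : EuclideanSpace ℝ (Fin (m + 1))} (hx : x ∈ upperHalfSpace m) :
    Integrable (fun z => g z • Φ (x - halfSpacePoint z 0)) volume := by
  obtain ⟨U, hU, -, C, hC, h⟩ := hΦ.exists_bound hx
  refine Integrable.mono' (((integrable_poissonWeight m).const_mul C).const_mul M)
    (aestronglyMeasurable_kernel hg hc hx) (Eventually.of_forall fun z => ?_)
  exact norm_smul_kernel_le (hM z) (h x (mem_of_mem_nhds hU) z) rfl

theorem continuousAt_kernelIntegral (hg : AEStronglyMeasurable g volume) (hM : ∀ z, |g z| ≤ M)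
    (hc : ContinuousOn Φ (upperHalfSpace m)) (hΦ : HasPoissonDecay Φ)
    {x : EuclideanSpace ℝ (Fin (m + 1))} (hx : x ∈ upperHalfSpace m) :
    ContinuousAt (kernelIntegral g Φ) x := by
  obtain ⟨U, hU, hUH, C, hC, h⟩ := hΦ.exists_bound hx
  refine continuousAt_of_dominated (bound := fun z => M * (C * (1 + ‖z‖ ^ 2) ^ (-(m + 1 : ℝ) / 2)))
    ?_ ?_ (((integrable_poissonWeight m).const_mul C).const_mul M) ?_
  · filter_upwards [hU] with y hy using aestronglyMeasurable_kernel hg hc (hUH hy)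
  · filter_upwards [hU] with y hy
    exact Eventually.of_forall fun z => norm_smul_kernel_le (hM z) (h y hy z) rfl
  · refine Eventually.of_forall fun z => ContinuousAt.const_smul ?_ _
    have hz := sub_halfSpacePoint_zero_mem hx z
    exact ContinuousAt.comp (g := Φ) (f := fun y => y - halfSpacePoint z 0)
      (hc.continuousAt ((isOpen_upperHalfSpace m).mem_nhds hz)) (by fun_prop)

theorem hasFDerivAt_kernelIntegral (hg : AEStronglyMeasurable g volume) (hM : ∀ z, |g z| ≤ M)
    (hd : DifferentiableOn ℝ Φ (upperHalfSpace m))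
    (hc : ContinuousOn (fderiv ℝ Φ) (upperHalfSpace m)) (hΦ : HasPoissonDecay Φ)
    (hΦ' : HasPoissonDecay (fderiv ℝ Φ))
    {x : EuclideanSpace ℝ (Fin (m + 1))} (hx : x ∈ upperHalfSpace m) :
    HasFDerivAt (kernelIntegral g Φ) (kernelIntegral g (fderiv ℝ Φ) x) x := by
  obtain ⟨U, hU, hUH, C, hC, h⟩ := hΦ'.exists_bound hx
  refine hasFDerivAt_integral_of_dominated_of_fderiv_le hU
    (bound := fun z => M * (C * (1 + ‖z‖ ^ 2) ^ (-(m + 1 : ℝ) / 2)))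
    (F' := fun y z => g z • fderiv ℝ Φ (y - halfSpacePoint z 0)) ?_
    (integrable_kernel hg hM hd.continuousOn hΦ hx) (aestronglyMeasurable_kernel hg hc hx) ?_
    (((integrable_poissonWeight m).const_mul C).const_mul M) ?_
  · filter_upwards [hU] with y hy using aestronglyMeasurable_kernel hg hd.continuousOn (hUH hy)
  · exact Eventually.of_forall fun z y hy => norm_smul_kernel_le (hM z) (h y hy z) rfl
  · refine Eventually.of_forall fun z y hy => HasFDerivAt.fun_const_smul ?_ _
    have hz := sub_halfSpacePoint_zero_mem (hUH hy) z
    have h1 := (hd.differentiableAt ((isOpen_upperHalfSpace m).mem_nhds hz)).hasFDerivAt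
    exact h1.comp y ((hasFDerivAt_id y).sub_const _)

end KernelIntegral

/-! ### Poisson integrals are harmonic -/

section PoissonIntegral

variable {m : ℕ} {g : EuclideanSpace ℝ (Fin m) → ℝ} {M : ℝ}

theorem continuousOn_poissonCore : ContinuousOn (poissonCore m) (upperHalfSpace m) := fun _ hx =>
  (contDiffAt_poissonCore (ne_zero_of_mem_upperHalfSpace hx)).continuousAt.continuousWithinAt

theorem continuousOn_fderiv_poissonCore :
    ContinuousOn (fderiv ℝ (poissonCore m)) (upperHalfSpace m) := fun _ hx =>
  (contDiffAt_fderiv_poissonCore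
    (ne_zero_of_mem_upperHalfSpace hx)).continuousAt.continuousWithinAt

theorem continuousOn_fderiv_fderiv_poissonCore :
    ContinuousOn (fderiv ℝ (fderiv ℝ (poissonCore m))) (upperHalfSpace m) := fun _ hx =>
  (contDiffAt_fderiv_fderiv_poissonCore
    (ne_zero_of_mem_upperHalfSpace hx)).continuousAt.continuousWithinAt

theorem hasFDerivAt_kernelIntegral_poissonCore (hg : AEStronglyMeasurable g volume)
    (hM : ∀ z, |g z| ≤ M) {x : EuclideanSpace ℝ (Fin (m + 1))} (hx : x ∈ upperHalfSpace m) :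
    HasFDerivAt (kernelIntegral g (poissonCore m))
      (kernelIntegral g (fderiv ℝ (poissonCore m)) x) x :=
  hasFDerivAt_kernelIntegral hg hM
    (fun _ hx => ((contDiffAt_poissonCore (ne_zero_of_mem_upperHalfSpace hx)).differentiableAt
      (by simp)).differentiableWithinAt)
    continuousOn_fderiv_poissonCore hasPoissonDecay_poissonCore
    hasPoissonDecay_fderiv_poissonCore hx

theorem hasFDerivAt_kernelIntegral_fderiv_poissonCore (hg : AEStronglyMeasurable g volume)
    (hM : ∀ z, |g z| ≤ M) {x : EuclideanSpace ℝ (Fin (m + 1))} (hx : x ∈ upperHalfSpace m) :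
    HasFDerivAt (kernelIntegral g (fderiv ℝ (poissonCore m)))
      (kernelIntegral g (fderiv ℝ (fderiv ℝ (poissonCore m))) x) x :=
  hasFDerivAt_kernelIntegral hg hM
    (fun _ hx => ((contDiffAt_fderiv_poissonCore
      (ne_zero_of_mem_upperHalfSpace hx)).differentiableAt (by simp)).differentiableWithinAt)
    continuousOn_fderiv_fderiv_poissonCore hasPoissonDecay_fderiv_poissonCore
    hasPoissonDecay_fderiv_fderiv_poissonCore hx

theorem harmonicOnNhd_kernelIntegral_poissonCore (hg : AEStronglyMeasurable g volume)
    (hM : ∀ z, |g z| ≤ M) :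
    HarmonicOnNhd (kernelIntegral g (poissonCore m)) (upperHalfSpace m) := by
  intro x hx
  have hH : ∀ᶠ y in 𝓝 x, y ∈ upperHalfSpace m := (isOpen_upperHalfSpace m).mem_nhds hx
  constructor
  · have h1 : ContDiffOn ℝ (1 + 1) (kernelIntegral g (poissonCore m)) (upperHalfSpace m) := by
      have hfd : ∀ y ∈ upperHalfSpace m, fderiv ℝ (kernelIntegral g (poissonCore m)) y =
          kernelIntegral g (fderiv ℝ (poissonCore m)) y := fun y hy =>
        (hasFDerivAt_kernelIntegral_poissonCore hg hM hy).fderiv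
      rw [contDiffOn_succ_iff_fderiv_of_isOpen (isOpen_upperHalfSpace m)]
      refine ⟨fun y hy => (hasFDerivAt_kernelIntegral_poissonCore hg hM
        hy).differentiableAt.differentiableWithinAt, by simp, ContDiffOn.congr ?_ hfd⟩
      rw [← zero_add (1 : WithTop ℕ∞),
        contDiffOn_succ_iff_fderiv_of_isOpen (isOpen_upperHalfSpace m)]
      refine ⟨fun y hy => (hasFDerivAt_kernelIntegral_fderiv_poissonCore hg hM
        hy).differentiableAt.differentiableWithinAt, by simp, contDiffOn_zero.2 ?_⟩
      refine ContinuousOn.congr (f := kernelIntegral g (fderiv ℝ (fderiv ℝ (poissonCore m))))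
        (fun y hy => (continuousAt_kernelIntegral hg hM continuousOn_fderiv_fderiv_poissonCore
          hasPoissonDecay_fderiv_fderiv_poissonCore hy).continuousWithinAt)
        fun y hy => (hasFDerivAt_kernelIntegral_fderiv_poissonCore hg hM hy).fderiv
    rw [one_add_one_eq_two] at h1
    exact h1.contDiffAt hH
  · filter_upwards [hH] with y hy
    have h1 : ∀ᶠ w in 𝓝 y, w ∈ upperHalfSpace m := (isOpen_upperHalfSpace m).mem_nhds hy
    rw [laplacian_eq_sum_of_hasFDerivAt (EuclideanSpace.basisFun _ ℝ)
      (h1.mono fun w hw => hasFDerivAt_kernelIntegral_poissonCore hg hM hw)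
      (hasFDerivAt_kernelIntegral_fderiv_poissonCore hg hM hy)]
    set b := EuclideanSpace.basisFun (Fin (m + 1)) ℝ
    have hint := integrable_kernel hg hM continuousOn_fderiv_fderiv_poissonCore
      hasPoissonDecay_fderiv_fderiv_poissonCore hy
    have h2 : ∀ i, kernelIntegral g (fderiv ℝ (fderiv ℝ (poissonCore m))) y (b i) (b i) =
        ∫ z, g z * fderiv ℝ (fderiv ℝ (poissonCore m)) (y - halfSpacePoint z 0) (b i) (b i) := by
      intro i
      rw [kernelIntegral, ContinuousLinearMap.integral_apply hint,
        ContinuousLinearMap.integral_apply (hint.apply_continuousLinearMap _)]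
      rfl
    rw [Finset.sum_congr rfl fun i _ => h2 i, ← integral_finsetSum]
    · refine integral_eq_zero_of_ae (Eventually.of_forall fun z => ?_)
      have h3 := laplacian_poissonCore
        (ne_zero_of_mem_upperHalfSpace (sub_halfSpacePoint_zero_mem hy z))
      rw [laplacian_eq_sum_fderiv_fderiv b] at h3
      simp only [← Finset.mul_sum, h3, mul_zero, Pi.zero_apply]
    · intro i _
      exact (hint.apply_continuousLinearMap (b i)).apply_continuousLinearMap (b i)

end PoissonIntegral

/-! ### Central projection of the ball onto the hyperplane at height one -/

section Gnomonic

variable {m : ℕ}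

theorem lintegral_eq_mul_lintegral_comp_smul {f : EuclideanSpace ℝ (Fin m) → ℝ≥0∞}
    (hf : Measurable f) {c : ℝ} (hc : c ≠ 0) :
    ∫⁻ z, f z = ENNReal.ofReal (|c| ^ m) * ∫⁻ z, f (c • z) := by
  have h1 : ∫⁻ z, f (c • z) = ∫⁻ z, f z ∂(Measure.map (c • ·) volume) :=
    (lintegral_map hf (measurable_const_smul c)).symm
  have hc' : 0 < |c| ^ m := by positivity
  rw [h1, Measure.map_addHaar_smul _ hc, lintegral_smul_measure, smul_eq_mul, ← mul_assoc,
    ← ENNReal.ofReal_mul hc'.le, finrank_euclideanSpace_fin, abs_inv, abs_pow,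
    mul_inv_cancel₀ hc'.ne', ENNReal.ofReal_one, one_mul]

theorem lintegral_abs_pow_Ioo (m : ℕ) {s : ℝ} (hs : 0 < s) :
    ∫⁻ t in Set.Ioo (-s) s, ENNReal.ofReal (|t| ^ m) =
      ENNReal.ofReal (2 / (m + 1)) * ENNReal.ofReal (s ^ (m + 1)) := by
  have h1 : ∀ b : ℝ, |b| = s → ∫⁻ t in Set.uIoc 0 b, ENNReal.ofReal (|t| ^ m) =
      ENNReal.ofReal (s ^ (m + 1) / (m + 1)) := by
    intro b hb
    rw [← ofReal_integral_eq_lintegral_ofReal]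
    · have := integral_pow_abs_sub_uIoc (a := 0) (b := b) m
      simp only [sub_zero, hb] at this
      rw [this]
    · exact ((continuous_abs.pow m).integrableOn_Ioc)
    · exact Eventually.of_forall fun t => by positivity
  have h2 := h1 s (abs_of_pos hs)
  have h3 := h1 (-s) (by rw [abs_neg, abs_of_pos hs])
  rw [Set.uIoc_of_le hs.le] at h2
  rw [Set.uIoc_of_ge (by linarith)] at h3
  rw [restrict_Ioo_eq_restrict_Ioc, ← Set.Ioc_union_Ioc_eq_Ioc (b := 0) (by linarith) hs.le,
    lintegral_union measurableSet_Ioc (Set.Ioc_disjoint_Ioc_of_le le_rfl), h2, h3,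
    ← ENNReal.ofReal_add (by positivity) (by positivity), ← ENNReal.ofReal_mul (by positivity)]
  congr 1
  ring

/-- Central projection: for a function that is constant on punctured lines through the origin,
the integral over the unit ball is a weighted integral over the hyperplane at height one. -/
theorem setLIntegral_ball_eq {h : EuclideanSpace ℝ (Fin (m + 1)) → ℝ≥0∞} (hm : Measurable h)
    (hh : ∀ c : ℝ, c ≠ 0 → ∀ x, h (c • x) = h x) :
    ∫⁻ x in Metric.ball 0 1, h x = ENNReal.ofReal (2 / (m + 1)) *
      ∫⁻ z : EuclideanSpace ℝ (Fin m), h (halfSpacePoint z 1) *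
        ENNReal.ofReal ((1 + ‖z‖ ^ 2) ^ (-(m + 1 : ℝ) / 2)) := by
  set F := (Metric.ball (0 : EuclideanSpace ℝ (Fin (m + 1))) 1).indicator h with hF
  have hFm : Measurable F := hm.indicator measurableSet_ball
  have hmeas : Measurable fun p : EuclideanSpace ℝ (Fin m) × ℝ => F (halfSpacePoint p.1 p.2) :=
    hFm.comp continuous_halfSpacePoint.measurable
  set s : EuclideanSpace ℝ (Fin m) → ℝ := fun z => (√(1 + ‖z‖ ^ 2))⁻¹ with hs
  have hspos : ∀ z, 0 < s z := fun z => by positivity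
  have hcs : Continuous s := by
    refine Continuous.inv₀ (by fun_prop) fun z => ?_
    positivity
  have hball : ∀ (t : ℝ) (z : EuclideanSpace ℝ (Fin m)), t ≠ 0 →
      F (t • halfSpacePoint z 1) =
        (Set.Ioo (-s z) (s z)).indicator (fun _ => h (halfSpacePoint z 1)) t := by
    intro t z ht
    have hn : ‖halfSpacePoint z 1‖ = √(1 + ‖z‖ ^ 2) := by
      rw [eq_comm, Real.sqrt_eq_iff_eq_sq (by positivity) (norm_nonneg _), norm_sq_halfSpacePoint]
      ring
    have h1 : t • halfSpacePoint z 1 ∈ Metric.ball (0 : EuclideanSpace ℝ (Fin (m + 1))) 1 ↔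
        t ∈ Set.Ioo (-s z) (s z) := by
      rw [mem_ball_zero_iff, norm_smul, hn, Real.norm_eq_abs, Set.mem_Ioo, ← abs_lt, hs,
        lt_inv_comm₀ (by positivity) (by positivity), lt_inv_comm₀ (by positivity) (by positivity),
        ← one_div, lt_div_iff₀ (by positivity)]
    by_cases h2 : t ∈ Set.Ioo (-s z) (s z)
    · rw [hF, Set.indicator_of_mem (h1.2 h2), Set.indicator_of_mem h2, hh t ht]
    · rw [hF, Set.indicator_of_notMem (h1.not.2 h2), Set.indicator_of_notMem h2]
  have hprod : Measurable fun p : ℝ × EuclideanSpace ℝ (Fin m) => ENNReal.ofReal (|p.1| ^ m) *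
      (Set.Ioo (-s p.2) (s p.2)).indicator (fun _ => h (halfSpacePoint p.2 1)) p.1 := by
    refine Measurable.mul (by fun_prop) ?_
    have hS : MeasurableSet {p : ℝ × EuclideanSpace ℝ (Fin m) | p.1 ∈ Set.Ioo (-s p.2) (s p.2)} :=
      ((isOpen_lt (hcs.comp continuous_snd).neg continuous_fst).inter
        (isOpen_lt continuous_fst (hcs.comp continuous_snd))).measurableSet
    have h1 : Measurable fun p : ℝ × EuclideanSpace ℝ (Fin m) => h (halfSpacePoint p.2 1) :=
      hm.comp ((continuous_halfSpacePoint_left 1).measurable.comp measurable_snd)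
    exact h1.indicator hS
  calc ∫⁻ x in Metric.ball 0 1, h x = ∫⁻ x, F x := by
        rw [hF, lintegral_indicator measurableSet_ball]
    _ = ∫⁻ p : EuclideanSpace ℝ (Fin m) × ℝ, F (halfSpacePoint p.1 p.2) :=
        (measurePreserving_halfSpacePoint.lintegral_comp hFm).symm
    _ = ∫⁻ t : ℝ, ∫⁻ z : EuclideanSpace ℝ (Fin m), F (halfSpacePoint z t) := by
        rw [Measure.volume_eq_prod, lintegral_prod_symm _ hmeas.aemeasurable]
    _ = ∫⁻ t : ℝ, ∫⁻ z : EuclideanSpace ℝ (Fin m), ENNReal.ofReal (|t| ^ m) *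
          (Set.Ioo (-s z) (s z)).indicator (fun _ => h (halfSpacePoint z 1)) t := by
        refine lintegral_congr_ae ?_
        filter_upwards [Measure.ae_ne volume (0 : ℝ)] with t ht
        have hmt : Measurable fun z : EuclideanSpace ℝ (Fin m) => F (halfSpacePoint z t) :=
          hFm.comp (continuous_halfSpacePoint_left t).measurable
        rw [lintegral_eq_mul_lintegral_comp_smul hmt ht,
          ← lintegral_const_mul' _ _ ENNReal.ofReal_ne_top]
        refine lintegral_congr fun z => ?_
        rw [← hball t z ht, smul_halfSpacePoint, mul_one]
    _ = ∫⁻ z : EuclideanSpace ℝ (Fin m), ∫⁻ t : ℝ, ENNReal.ofReal (|t| ^ m) *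
          (Set.Ioo (-s z) (s z)).indicator (fun _ => h (halfSpacePoint z 1)) t :=
        lintegral_lintegral_swap hprod.aemeasurable
    _ = ∫⁻ z : EuclideanSpace ℝ (Fin m), ENNReal.ofReal (2 / (m + 1)) *
          (h (halfSpacePoint z 1) * ENNReal.ofReal ((1 + ‖z‖ ^ 2) ^ (-(m + 1 : ℝ) / 2))) := by
        refine lintegral_congr fun z => ?_
        have h1 : s z ^ (m + 1) = (1 + ‖z‖ ^ 2) ^ (-(m + 1 : ℝ) / 2) := by
          rw [hs]
          simp only
          rw [← Real.rpow_natCast, Real.sqrt_eq_rpow, ← Real.rpow_neg (by positivity),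
            ← Real.rpow_mul (by positivity)]
          congr 1
          push_cast
          ring
        have h2 : ∀ t : ℝ, ENNReal.ofReal (|t| ^ m) *
            (Set.Ioo (-s z) (s z)).indicator (fun _ => h (halfSpacePoint z 1)) t =
            h (halfSpacePoint z 1) *
              (Set.Ioo (-s z) (s z)).indicator (fun t => ENNReal.ofReal (|t| ^ m)) t := by
          intro t
          by_cases ht : t ∈ Set.Ioo (-s z) (s z)
          · simp only [Set.indicator_of_mem ht, mul_comm]
          · simp only [Set.indicator_of_notMem ht, mul_zero]
        rw [lintegral_congr h2, lintegral_const_mul, lintegral_indicator measurableSet_Ioo,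
          lintegral_abs_pow_Ioo m (hspos z), h1]
        · ring
        · exact Measurable.indicator (by fun_prop) measurableSet_Ioo
    _ = _ := lintegral_const_mul' _ _ ENNReal.ofReal_ne_top

theorem setIntegral_ball_eq {h : EuclideanSpace ℝ (Fin (m + 1)) → ℝ} (hm : Measurable h)
    (h0 : ∀ x, 0 ≤ h x) (hh : ∀ c : ℝ, c ≠ 0 → ∀ x, h (c • x) = h x) :
    ∫ x in Metric.ball 0 1, h x = 2 / (m + 1) *
      ∫ z : EuclideanSpace ℝ (Fin m), h (halfSpacePoint z 1) *
        (1 + ‖z‖ ^ 2) ^ (-(m + 1 : ℝ) / 2) := by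
  have hm' : Measurable fun z : EuclideanSpace ℝ (Fin m) => h (halfSpacePoint z 1) :=
    hm.comp (continuous_halfSpacePoint_left 1).measurable
  have hw : Measurable fun z : EuclideanSpace ℝ (Fin m) =>
    (1 + ‖z‖ ^ 2) ^ (-(m + 1 : ℝ) / 2) := by fun_prop
  rw [integral_eq_lintegral_of_nonneg_ae (Eventually.of_forall h0) hm.aestronglyMeasurable,
    integral_eq_lintegral_of_nonneg_ae
      (Eventually.of_forall fun z => mul_nonneg (h0 _) (by positivity))
      (hm'.mul hw).aestronglyMeasurable,
    setLIntegral_ball_eq (h := fun x => ENNReal.ofReal (h x)) hm.ennreal_ofReal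
      (fun c hc x => by rw [hh c hc x]),
    ENNReal.toReal_mul, ENNReal.toReal_ofReal (by positivity)]
  simp_rw [ENNReal.ofReal_mul (h0 _)]

theorem sphereArea_eq (n : ℕ) : sphereArea n =
    n * (volume : Measure (EuclideanSpace ℝ (Fin n))).real (Metric.ball 0 1) := by
  rw [sphereArea, Measure.toSphere_real_apply_univ, finrank_euclideanSpace_fin]

/-- The total mass of the unnormalized Poisson kernel is half the area of the unit sphere. -/
theorem integral_poissonWeight (m : ℕ) :
    ∫ z : EuclideanSpace ℝ (Fin m), (1 + ‖z‖ ^ 2) ^ (-(m + 1 : ℝ) / 2) =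
      sphereArea (m + 1) / 2 := by
  have h := setIntegral_ball_eq (m := m) (h := fun _ => 1) measurable_const (by simp) (by simp)
  simp only [one_mul, setIntegral_const, smul_eq_mul, mul_one] at h
  rw [sphereArea_eq, h]
  push_cast
  field_simp

theorem sphereArea_pos {n : ℕ} (hn : 0 < n) : 0 < sphereArea n := by
  rw [sphereArea_eq]
  have : 0 < (volume : Measure (EuclideanSpace ℝ (Fin n))).real (Metric.ball 0 1) :=
    ENNReal.toReal_pos (Metric.measure_ball_pos volume _ one_pos).ne' measure_ball_lt_top.ne
  positivity

end Gnomonic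

/-! ### The extremal direction -/

section Extremal

variable {m : ℕ}

/-- The absolute value of the trace-free quadratic form `n ⟪a, x⟫² - ‖a‖² ‖x‖²`, `n = m + 1`,
normalized to be constant on rays. -/
noncomputable def axialForm (a x : EuclideanSpace ℝ (Fin (m + 1))) : ℝ :=
  |(m + 1) * inner ℝ a x ^ 2 / ‖x‖ ^ 2 - ‖a‖ ^ 2|

/-- The angular part of the derivative of the Poisson kernel in the direction `v`. -/
noncomputable def directionalForm (v x : EuclideanSpace ℝ (Fin (m + 1))) : ℝ :=
  |inner ℝ (normalVec m) v - (m + 1) * inner ℝ (normalVec m) x * inner ℝ x v / ‖x‖ ^ 2|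

theorem measurable_axialForm (a : EuclideanSpace ℝ (Fin (m + 1))) : Measurable (axialForm a) := by
  unfold axialForm
  have : Continuous fun x : EuclideanSpace ℝ (Fin (m + 1)) => inner ℝ a x := by fun_prop
  have := this.measurable
  simp only [← Real.norm_eq_abs]
  fun_prop

theorem measurable_directionalForm (v : EuclideanSpace ℝ (Fin (m + 1))) :
    Measurable (directionalForm v) := by
  unfold directionalForm
  have h1 : Continuous fun x : EuclideanSpace ℝ (Fin (m + 1)) => inner ℝ (normalVec m) x := by
    fun_prop
  have h2 : Continuous fun x : EuclideanSpace ℝ (Fin (m + 1)) => inner ℝ x v := by fun_prop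
  have := h1.measurable
  have := h2.measurable
  simp only [← Real.norm_eq_abs]
  fun_prop

theorem integrableOn_axialForm (a : EuclideanSpace ℝ (Fin (m + 1))) :
    IntegrableOn (axialForm a) (Metric.ball 0 1) := by
  refine Measure.integrableOn_of_bounded (M := (m + 2) * ‖a‖ ^ 2) measure_ball_lt_top.ne
    (measurable_axialForm a).aestronglyMeasurable (Eventually.of_forall fun x => ?_)
  rw [axialForm, Real.norm_eq_abs, abs_abs]
  have h1 : inner ℝ a x ^ 2 / ‖x‖ ^ 2 ≤ ‖a‖ ^ 2 := by
    refine div_le_of_le_mul₀ (by positivity) (by positivity) ?_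
    rw [← mul_pow, ← sq_abs]
    gcongr
    exact abs_real_inner_le_norm a x
  have h2 : 0 ≤ inner ℝ a x ^ 2 / ‖x‖ ^ 2 := by positivity
  rw [mul_div_assoc, abs_le]
  have h3 : (0 : ℝ) ≤ m := Nat.cast_nonneg m
  have h4 : (0 : ℝ) ≤ ‖a‖ ^ 2 := by positivity
  constructor <;> nlinarith

theorem setIntegral_axialForm_map (T : EuclideanSpace ℝ (Fin (m + 1)) ≃ₗᵢ[ℝ]
    EuclideanSpace ℝ (Fin (m + 1))) (a : EuclideanSpace ℝ (Fin (m + 1))) :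
    ∫ x in Metric.ball 0 1, axialForm (T a) x = ∫ x in Metric.ball 0 1, axialForm a x := by
  have h := T.measurePreserving.setIntegral_preimage_emb
    T.toHomeomorph.measurableEmbedding (axialForm (T a)) (Metric.ball 0 1)
  rw [← h]
  have h1 : T ⁻¹' Metric.ball 0 1 = Metric.ball 0 1 := by
    rw [T.preimage_ball, map_zero]
  rw [h1]
  refine setIntegral_congr_fun measurableSet_ball fun x _ => ?_
  simp [axialForm]

/-- Rotation invariance and homogeneity of the mean value of the axial form. -/
theorem setIntegral_axialForm (a : EuclideanSpace ℝ (Fin (m + 1))) :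
    ∫ x in Metric.ball 0 1, axialForm a x =
      ‖a‖ ^ 2 * ∫ x in Metric.ball 0 1, axialForm (normalVec m) x := by
  have hsmul : ∀ (c : ℝ) (b x : EuclideanSpace ℝ (Fin (m + 1))),
      axialForm (c • b) x = c ^ 2 * axialForm b x := by
    intro c b x
    have hc : c ^ 2 = |c ^ 2| := (abs_of_nonneg (sq_nonneg c)).symm
    rw [axialForm, axialForm, hc, ← abs_mul, inner_smul_left, norm_smul, mul_pow ‖c‖,
      Real.norm_eq_abs, sq_abs]
    congr 1
    simp
    ring
  have hT : ‖‖a‖ • normalVec m‖ = ‖a‖ := by simp [norm_smul, norm_normalVec]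
  -- the reflection in the bisecting hyperplane carries `‖a‖ e` to `a`
  have h1 := setIntegral_axialForm_map
    (ℝ ∙ (‖a‖ • normalVec m - a))ᗮ.reflection (‖a‖ • normalVec m)
  rw [Submodule.reflection_sub hT] at h1
  rw [h1, ← integral_const_mul]
  simp_rw [hsmul]

/-- Polarization and the triangle inequality: the quadratic form belonging to the direction `v` is
a combination of two axial forms with orthogonal axes, the bisectors of `v` and the normal. -/
theorem directionalForm_le (v x : EuclideanSpace ℝ (Fin (m + 1))) :
    directionalForm v x ≤
      (1 / 4) * axialForm (v + normalVec m) x + (1 / 4) * axialForm (v - normalVec m) x := by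
  set e := normalVec m
  have h1 : inner ℝ e v - (m + 1) * inner ℝ e x * inner ℝ x v / ‖x‖ ^ 2 =
      (1 / 4) * -((m + 1) * inner ℝ (v + e) x ^ 2 / ‖x‖ ^ 2 - ‖v + e‖ ^ 2) +
      (1 / 4) * ((m + 1) * inner ℝ (v - e) x ^ 2 / ‖x‖ ^ 2 - ‖v - e‖ ^ 2) := by
    rw [norm_add_sq_real, norm_sub_sq_real, inner_add_left, inner_sub_left, real_inner_comm v e,
      real_inner_comm v x]
    ring
  rw [directionalForm, h1]
  refine (abs_add_le _ _).trans ?_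
  rw [abs_mul, abs_mul, abs_neg, abs_of_pos (by norm_num : (0 : ℝ) < 1 / 4)]
  rfl

theorem directionalForm_normalVec (x : EuclideanSpace ℝ (Fin (m + 1))) :
    directionalForm (normalVec m) x = axialForm (normalVec m) x := by
  rw [directionalForm, axialForm, abs_sub_comm, real_inner_self_eq_norm_sq,
    real_inner_comm (normalVec m) x]
  congr 1
  ring

theorem setIntegral_directionalForm_le {v : EuclideanSpace ℝ (Fin (m + 1))} (hv : ‖v‖ = 1) :
    ∫ x in Metric.ball 0 1, directionalForm v x ≤
      ∫ x in Metric.ball 0 1, directionalForm (normalVec m) x := by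
  have hi := fun a : EuclideanSpace ℝ (Fin (m + 1)) =>
    (integrableOn_axialForm a).const_mul (1 / 4)
  calc ∫ x in Metric.ball 0 1, directionalForm v x
      ≤ ∫ x in Metric.ball 0 1, ((1 / 4) * axialForm (v + normalVec m) x +
          (1 / 4) * axialForm (v - normalVec m) x) :=
        integral_mono_of_nonneg (Eventually.of_forall fun x => abs_nonneg _)
          ((hi _).add (hi _)) (Eventually.of_forall (directionalForm_le v))
    _ = ∫ x in Metric.ball 0 1, axialForm (normalVec m) x := by
        rw [integral_add (hi _) (hi _), integral_const_mul, integral_const_mul,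
          setIntegral_axialForm (v + _), setIntegral_axialForm (v - _), ← mul_assoc, ← mul_assoc,
          ← add_mul, norm_add_sq_real, norm_sub_sq_real, hv, norm_normalVec]
        ring
    _ = _ := by simp_rw [directionalForm_normalVec]

theorem norm_sq_rpow_halfSpacePoint_one (z : EuclideanSpace ℝ (Fin m)) :
    (‖halfSpacePoint z 1‖ ^ 2) ^ (-((m + 1 : ℝ) / 2)) = (1 + ‖z‖ ^ 2) ^ (-(m + 1 : ℝ) / 2) := by
  rw [norm_sq_halfSpacePoint, one_pow, add_comm, neg_div]

theorem halfSpacePoint_mem {z : EuclideanSpace ℝ (Fin m)} {t : ℝ} (ht : 0 < t) :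
    halfSpacePoint z t ∈ upperHalfSpace m := by
  simpa [upperHalfSpace] using ht

theorem integral_abs_fderiv_poissonCore_one (v : EuclideanSpace ℝ (Fin (m + 1))) :
    ∫ z : EuclideanSpace ℝ (Fin m), |fderiv ℝ (poissonCore m) (halfSpacePoint z 1) v| =
      (m + 1) / 2 * ∫ x in Metric.ball 0 1, directionalForm v x := by
  rw [setIntegral_ball_eq (measurable_directionalForm v) (fun x => abs_nonneg _)]
  · rw [← mul_assoc, show ((m : ℝ) + 1) / 2 * (2 / (m + 1)) = 1 by field_simp, one_mul]
    refine integral_congr_ae (Eventually.of_forall fun z => ?_)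
    simp only
    rw [fderiv_poissonCore_apply (ne_zero_of_mem_upperHalfSpace (halfSpacePoint_mem one_pos)),
      norm_sq_rpow_halfSpacePoint_one, abs_mul, abs_of_nonneg (by positivity), mul_comm]
    rfl
  · intro c hc x
    rw [directionalForm, directionalForm, inner_smul_left, inner_smul_right, norm_smul, mul_pow,
      Real.norm_eq_abs, sq_abs]
    congr 2
    rcases eq_or_ne x 0 with rfl | hx
    · simp
    have : ‖x‖ ≠ 0 := by simpa using hx
    simp
    field_simp

end Extremal

/-! ### The value of the extremal integral -/

section RadialIntegral

variable {m : ℕ}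

/-- The radial primitive `r^m (1 + r²)^{-(m+1)/2}` of the normal derivative of the Poisson kernel
times `r^{m-1}`. -/
noncomputable def radialPrimitive (m : ℕ) (r : ℝ) : ℝ :=
  r ^ m * (1 + r ^ 2) ^ (-(m + 1 : ℝ) / 2)

theorem hasDerivAt_radialPrimitive (hm : 1 ≤ m) (r : ℝ) :
    HasDerivAt (radialPrimitive m)
      (r ^ (m - 1) * ((m - r ^ 2) * (1 + r ^ 2) ^ (-(m + 3 : ℝ) / 2))) r := by
  have h0 : (1 + r ^ 2 : ℝ) ≠ 0 := by positivity
  have h1 : HasDerivAt (fun r : ℝ => 1 + r ^ 2) (2 * r) r := by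
    simpa using (hasDerivAt_pow 2 r).const_add 1
  have h2 := (hasDerivAt_pow m r).mul (h1.rpow_const (p := -(m + 1 : ℝ) / 2) (Or.inl h0))
  refine h2.congr_deriv ?_
  obtain ⟨k, rfl⟩ := Nat.exists_eq_add_of_le' hm
  have h3 : ((1 + r ^ 2 : ℝ)) ^ (-((k + 1 : ℕ) + 1 : ℝ) / 2) =
      (1 + r ^ 2) ^ (-((k + 1 : ℕ) + 3 : ℝ) / 2) * (1 + r ^ 2) := by
    rw [← Real.rpow_add_one h0]
    congr 1
    ring
  have h4 : (-((k + 1 : ℕ) + 1 : ℝ) / 2) - 1 = -((k + 1 : ℕ) + 3 : ℝ) / 2 := by ring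
  rw [h4, h3]
  simp
  ring

theorem tendsto_radialPrimitive (m : ℕ) : Tendsto (radialPrimitive m) atTop (𝓝 0) := by
  refine squeeze_zero' ?_ ?_ tendsto_inv_atTop_zero
  · filter_upwards [eventually_gt_atTop 0] with r hr
    unfold radialPrimitive
    positivity
  · filter_upwards [eventually_gt_atTop 0] with r hr
    have h1 : (1 + r ^ 2) ^ (-(m + 1 : ℝ) / 2) ≤ (r ^ 2) ^ (-(m + 1 : ℝ) / 2) :=
      Real.rpow_le_rpow_of_nonpos (by positivity) (by linarith) (by
        have : (0 : ℝ) ≤ m := Nat.cast_nonneg m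
        linarith)
    have h2 : (r ^ 2 : ℝ) ^ (-(m + 1 : ℝ) / 2) = (r ^ m)⁻¹ * r⁻¹ := by
      rw [← Real.rpow_natCast r 2, ← Real.rpow_mul hr.le, ← mul_inv, ← pow_succ,
        ← Real.rpow_natCast r (m + 1), ← Real.rpow_neg hr.le]
      congr 1
      push_cast
      ring
    calc radialPrimitive m r ≤ r ^ m * ((r ^ m)⁻¹ * r⁻¹) := by
          unfold radialPrimitive
          rw [← h2]
          gcongr
      _ = r⁻¹ := by field_simp

/-- The integrand changes sign at `r = √m`, and its primitive vanishes at `0` and at `∞`. -/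
theorem integral_Ioi_radial (hm : 1 ≤ m) :
    ∫ r in Set.Ioi (0 : ℝ), r ^ (m - 1) * (|(m : ℝ) - r ^ 2| * (1 + r ^ 2) ^ (-(m + 3 : ℝ) / 2)) =
      2 * radialPrimitive m √m := by
  -- `A'` is the derivative of the primitive, and `B = |A'|` changes from `A'` to `-A'` at `√m`
  set A' : ℝ → ℝ := fun r => r ^ (m - 1) * ((m - r ^ 2) * (1 + r ^ 2) ^ (-(m + 3 : ℝ) / 2)) with hA'
  set B : ℝ → ℝ := fun r => r ^ (m - 1) * (|(m : ℝ) - r ^ 2| * (1 + r ^ 2) ^ (-(m + 3 : ℝ) / 2))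
    with hB
  have hcont : Continuous A' := by
    refine (continuous_pow _).mul (Continuous.mul (by fun_prop) ?_)
    refine Continuous.rpow_const (by fun_prop) fun r => Or.inl ?_
    positivity
  have hs : (0 : ℝ) ≤ √m := Real.sqrt_nonneg _
  have hder := hasDerivAt_radialPrimitive hm
  have hneg : ∀ r ∈ Set.Ioi √(m : ℝ), A' r ≤ 0 := by
    intro r hr
    have hr0 : 0 ≤ r := hs.trans (le_of_lt hr)
    have : (m : ℝ) ≤ r ^ 2 := (Real.sqrt_le_left hr0).1 (le_of_lt hr)
    have h1 : 0 ≤ (1 + r ^ 2 : ℝ) ^ (-(m + 3 : ℝ) / 2) := by positivity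
    exact mul_nonpos_of_nonneg_of_nonpos (by positivity)
      (mul_nonpos_of_nonpos_of_nonneg (by linarith) h1)
  have hB1 : ∀ r ∈ Set.Ioc 0 √(m : ℝ), B r = A' r := by
    intro r hr
    have : r ^ 2 ≤ m := by
      rw [← Real.sq_sqrt (Nat.cast_nonneg m)]
      exact pow_le_pow_left₀ hr.1.le hr.2 2
    simp only [hA', hB]
    rw [abs_of_nonneg (by linarith)]
  have hB2 : ∀ r ∈ Set.Ioi √(m : ℝ), B r = -A' r := by
    intro r hr
    have : (m : ℝ) ≤ r ^ 2 := (Real.sqrt_le_left (hs.trans (le_of_lt hr))).1 (le_of_lt hr)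
    simp only [hA', hB]
    rw [abs_of_nonpos (by linarith)]
    ring
  have hint1 : IntegrableOn A' (Set.Ioc 0 √(m : ℝ)) := hcont.integrableOn_Ioc
  have hint2 : IntegrableOn A' (Set.Ioi √(m : ℝ)) :=
    integrableOn_Ioi_deriv_of_nonpos' (fun r _ => hder r) hneg (tendsto_radialPrimitive m)
  have h1 : ∫ r in Set.Ioc 0 √(m : ℝ), B r = radialPrimitive m √m := by
    rw [setIntegral_congr_fun measurableSet_Ioc hB1, ← intervalIntegral.integral_of_le hs,
      intervalIntegral.integral_eq_sub_of_hasDerivAt (fun r _ => hder r)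
        (hcont.intervalIntegrable _ _)]
    simp [radialPrimitive, Nat.one_le_iff_ne_zero.1 hm]
  have h2 : ∫ r in Set.Ioi √(m : ℝ), B r = radialPrimitive m √m := by
    rw [setIntegral_congr_fun measurableSet_Ioi hB2, integral_neg,
      integral_Ioi_of_hasDerivAt_of_nonpos' (fun r _ => hder r) hneg (tendsto_radialPrimitive m)]
    ring
  rw [← Set.Ioc_union_Ioi_eq_Ioi hs, setIntegral_union (Set.Ioc_disjoint_Ioi le_rfl)
    measurableSet_Ioi (hint1.congr_fun (fun r hr => (hB1 r hr).symm) measurableSet_Ioc)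
    (hint2.neg.congr_fun (fun r hr => (hB2 r hr).symm) measurableSet_Ioi), h1, h2]
  ring

theorem radialPrimitive_sqrt (m : ℕ) :
    radialPrimitive m √m = (m : ℝ) ^ ((m : ℝ) / 2) * (m + 1 : ℝ) ^ (-(m + 1 : ℝ) / 2) := by
  rw [radialPrimitive, Real.sq_sqrt (Nat.cast_nonneg m), Real.sqrt_eq_rpow, ← Real.rpow_natCast,
    ← Real.rpow_mul (Nat.cast_nonneg m), add_comm (1 : ℝ)]
  congr 2
  ring

theorem fderiv_poissonCore_normalVec (z : EuclideanSpace ℝ (Fin m)) (t : ℝ) (ht : 0 < t) :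
    fderiv ℝ (poissonCore m) (halfSpacePoint z t) (normalVec m) =
      (‖z‖ ^ 2 - m * t ^ 2) * (‖z‖ ^ 2 + t ^ 2) ^ (-(m + 3 : ℝ) / 2) := by
  have h0 : ‖z‖ ^ 2 + t ^ 2 ≠ 0 := by positivity
  rw [fderiv_poissonCore_apply (ne_zero_of_mem_upperHalfSpace (halfSpacePoint_mem ht)),
    real_inner_comm (normalVec m) (halfSpacePoint z t), inner_normalVec, inner_normalVec,
    halfSpacePoint_last, norm_sq_halfSpacePoint]
  have h1 : normalVec m (Fin.last m) = 1 := by simp [normalVec]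
  have h2 : (‖z‖ ^ 2 + t ^ 2) ^ (-((m + 1 : ℝ) / 2)) =
      (‖z‖ ^ 2 + t ^ 2) ^ (-(m + 3 : ℝ) / 2) * (‖z‖ ^ 2 + t ^ 2) := by
    rw [← Real.rpow_add_one h0]
    congr 1
    ring
  rw [h1, h2]
  field_simp
  ring

theorem integral_abs_fderiv_poissonCore_normalVec (hm : 1 ≤ m) :
    ∫ z : EuclideanSpace ℝ (Fin m),
      |fderiv ℝ (poissonCore m) (halfSpacePoint z 1) (normalVec m)| =
      gradConst (m + 1) * (sphereArea (m + 1) / 2) := by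
  have hne : Nontrivial (EuclideanSpace ℝ (Fin m)) := by
    have : Nonempty (Fin m) := ⟨⟨0, hm⟩⟩
    infer_instance
  have h1 : ∀ z : EuclideanSpace ℝ (Fin m),
      |fderiv ℝ (poissonCore m) (halfSpacePoint z 1) (normalVec m)| =
        (fun r : ℝ => |(m : ℝ) - r ^ 2| * (1 + r ^ 2) ^ (-(m + 3 : ℝ) / 2)) ‖z‖ := by
    intro z
    rw [fderiv_poissonCore_normalVec z 1 one_pos, abs_mul, abs_sub_comm, one_pow, mul_one,
      add_comm (‖z‖ ^ 2), abs_of_nonneg (a := (1 + ‖z‖ ^ 2) ^ (-(m + 3 : ℝ) / 2)) (by positivity)]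
  rw [integral_congr_ae (Eventually.of_forall h1), integral_fun_norm_addHaar volume
    (fun r : ℝ => |(m : ℝ) - r ^ 2| * (1 + r ^ 2) ^ (-(m + 3 : ℝ) / 2)), finrank_euclideanSpace_fin]
  simp only [smul_eq_mul, nsmul_eq_mul]
  rw [integral_Ioi_radial hm, radialPrimitive_sqrt, ← mul_assoc, ← sphereArea_eq, gradConst]
  have h2 := (sphereArea_pos (Nat.succ_pos m)).ne'
  have h3 : (0 : ℝ) < m + 1 := by positivity
  push_cast
  rw [neg_div, Real.rpow_neg h3.le, add_sub_cancel_right]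
  field_simp
  ring

theorem gradConst_pos (hm : 1 ≤ m) : 0 < gradConst (m + 1) := by
  have h1 := sphereArea_pos (Nat.succ_pos m)
  have h2 := sphereArea_pos (n := m) hm
  have h3 : (0 : ℝ) < m := by exact_mod_cast hm
  unfold gradConst
  push_cast
  rw [add_sub_cancel_right]
  positivity

/-- The unnormalized form of the sharp `L¹` estimate of the derivative of the Poisson kernel at
height one. -/
theorem integral_abs_fderiv_poissonCore_one_le (hm : 1 ≤ m) {v : EuclideanSpace ℝ (Fin (m + 1))}
    (hv : ‖v‖ = 1) :
    ∫ z : EuclideanSpace ℝ (Fin m), |fderiv ℝ (poissonCore m) (halfSpacePoint z 1) v| ≤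
      gradConst (m + 1) * (sphereArea (m + 1) / 2) := by
  rw [← integral_abs_fderiv_poissonCore_normalVec hm, integral_abs_fderiv_poissonCore_one,
    integral_abs_fderiv_poissonCore_one]
  gcongr ?_ * ?_
  exact setIntegral_directionalForm_le hv

/-- Translation and dilation reduce integrals of homogeneous kernels to height one. -/
theorem integral_homogeneous_kernel {Φ : EuclideanSpace ℝ (Fin (m + 1)) → ℝ} {k : ℝ}
    (h : ∀ c : ℝ, 0 < c → ∀ x, Φ (c • x) = c ^ k * Φ x) {x : EuclideanSpace ℝ (Fin (m + 1))}
    (hx : x ∈ upperHalfSpace m) :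
    ∫ z, Φ (x - halfSpacePoint z 0) =
      (x (Fin.last m)) ^ (m + k) * ∫ z, Φ (halfSpacePoint z 1) := by
  set t := x (Fin.last m) with ht
  have htpos : 0 < t := hx
  have h1 : ∀ z, Φ (x - halfSpacePoint z 0) =
      (fun z => Φ (halfSpacePoint z t)) (tangentialPart x - z) := by
    intro z
    conv_lhs => rw [← halfSpacePoint_tangentialPart x]
    rw [halfSpacePoint_sub, sub_zero]
  simp_rw [h1]
  rw [integral_sub_left_eq_self (fun z => Φ (halfSpacePoint z t)) volume (tangentialPart x)]
  have h2 := Measure.integral_comp_smul (volume : Measure (EuclideanSpace ℝ (Fin m)))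
    (fun z => Φ (halfSpacePoint z t)) t
  have h3 : ∀ z : EuclideanSpace ℝ (Fin m),
      Φ (halfSpacePoint (t • z) t) = t ^ k * Φ (halfSpacePoint z 1) := by
    intro z
    rw [← h t htpos, smul_halfSpacePoint, mul_one]
  simp_rw [h3] at h2
  rw [integral_const_mul, finrank_euclideanSpace_fin, abs_of_pos (by positivity), smul_eq_mul] at h2
  rw [Real.rpow_add htpos, Real.rpow_natCast, mul_assoc, h2]
  field_simp

theorem integral_poissonCore {x : EuclideanSpace ℝ (Fin (m + 1))} (hx : x ∈ upperHalfSpace m) :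
    ∫ z, poissonCore m (x - halfSpacePoint z 0) = sphereArea (m + 1) / 2 := by
  rw [integral_homogeneous_kernel (poissonCore_smul m) hx, add_neg_cancel, Real.rpow_zero, one_mul,
    ← integral_poissonWeight]
  refine integral_congr_ae (Eventually.of_forall fun z => ?_)
  simp only
  rw [poissonCore, norm_sq_rpow_halfSpacePoint_one, inner_normalVec, halfSpacePoint_last, one_mul]

theorem integral_abs_fderiv_poissonCore (v : EuclideanSpace ℝ (Fin (m + 1)))
    {x : EuclideanSpace ℝ (Fin (m + 1))} (hx : x ∈ upperHalfSpace m) :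
    ∫ z, |fderiv ℝ (poissonCore m) (x - halfSpacePoint z 0) v| = (x (Fin.last m))⁻¹ *
      ∫ z : EuclideanSpace ℝ (Fin m), |fderiv ℝ (poissonCore m) (halfSpacePoint z 1) v| := by
  rw [integral_homogeneous_kernel (Φ := fun y => |fderiv ℝ (poissonCore m) y v|)
    (k := -(m : ℝ) - 1) (fun c hc y => ?_) hx]
  · rw [show (m : ℝ) + (-m - 1) = -1 by ring, Real.rpow_neg_one]
  · rw [fderiv_smul_of_homogeneous (poissonCore_smul m) c hc y, smul_apply,
      smul_eq_mul, abs_mul, abs_of_pos (by positivity)]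

end RadialIntegral

/-! ### The Poisson representation of bounded harmonic functions -/

section Representation

variable {m : ℕ} {g : EuclideanSpace ℝ (Fin m) → ℝ} {M : ℝ}

/-- The Poisson integral of the boundary function `g` on `ℝ^m`. -/
noncomputable def poissonIntegral (g : EuclideanSpace ℝ (Fin m) → ℝ)
    (x : EuclideanSpace ℝ (Fin (m + 1))) : ℝ :=
  2 / sphereArea (m + 1) * kernelIntegral g (poissonCore m) x

theorem harmonicOnNhd_poissonIntegral (hg : AEStronglyMeasurable g volume) (hM : ∀ z, |g z| ≤ M) :
    HarmonicOnNhd (poissonIntegral g) (upperHalfSpace m) :=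
  (harmonicOnNhd_kernelIntegral_poissonCore hg hM).const_smul (c := 2 / sphereArea (m + 1))

theorem poissonCore_nonneg {x : EuclideanSpace ℝ (Fin (m + 1))} (hx : x ∈ upperHalfSpace m) :
    0 ≤ poissonCore m x := by
  have : 0 < x (Fin.last m) := hx
  rw [poissonCore, inner_normalVec]
  positivity

theorem integrable_poissonCore {x : EuclideanSpace ℝ (Fin (m + 1))} (hx : x ∈ upperHalfSpace m) :
    Integrable fun z => poissonCore m (x - halfSpacePoint z 0) := by
  simpa using integrable_kernel (g := fun _ => 1) (M := 1) aestronglyMeasurable_const (by simp)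
    continuousOn_poissonCore hasPoissonDecay_poissonCore hx

theorem integrable_fderiv_poissonCore {x : EuclideanSpace ℝ (Fin (m + 1))}
    (hx : x ∈ upperHalfSpace m) :
    Integrable fun z => fderiv ℝ (poissonCore m) (x - halfSpacePoint z 0) := by
  simpa using integrable_kernel (g := fun _ => 1) (M := 1) aestronglyMeasurable_const (by simp)
    continuousOn_fderiv_poissonCore hasPoissonDecay_fderiv_poissonCore hx

theorem abs_poissonIntegral_le (hM : ∀ z, |g z| ≤ M) {x : EuclideanSpace ℝ (Fin (m + 1))}
    (hx : x ∈ upperHalfSpace m) : |poissonIntegral g x| ≤ M := by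
  have hω := sphereArea_pos (Nat.succ_pos m)
  have h1 : |kernelIntegral g (poissonCore m) x| ≤ M * (sphereArea (m + 1) / 2) := by
    rw [← integral_poissonCore hx, ← integral_const_mul]
    refine norm_integral_le_of_norm_le (f := fun z => g z • poissonCore m (x - halfSpacePoint z 0))
      ((integrable_poissonCore hx).const_mul M) (Eventually.of_forall fun z => ?_)
    have h2 := poissonCore_nonneg (sub_halfSpacePoint_zero_mem hx z)
    rw [norm_smul, Real.norm_of_nonneg h2]
    exact mul_le_mul_of_nonneg_right (hM z) h2
  rw [poissonIntegral, abs_mul, abs_of_pos (by positivity)]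
  calc 2 / sphereArea (m + 1) * |kernelIntegral g (poissonCore m) x|
      ≤ 2 / sphereArea (m + 1) * (M * (sphereArea (m + 1) / 2)) := by gcongr
    _ = M := by field_simp

/-- The Poisson integral in dilated variables. Unlike the convolution form it makes sense, and is
continuous, on the whole space, and it equals `g` on the boundary hyperplane. -/
noncomputable def dilatedPoissonIntegral (g : EuclideanSpace ℝ (Fin m) → ℝ)
    (x : EuclideanSpace ℝ (Fin (m + 1))) : ℝ :=
  2 / sphereArea (m + 1) * ∫ s : EuclideanSpace ℝ (Fin m),
    g (tangentialPart x - x (Fin.last m) • s) * (1 + ‖s‖ ^ 2) ^ (-(m + 1 : ℝ) / 2)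

theorem continuous_dilatedPoissonIntegral (hg : Continuous g) (hM : ∀ z, |g z| ≤ M) :
    Continuous (dilatedPoissonIntegral g) := by
  refine Continuous.mul continuous_const ?_
  refine continuous_of_dominated (bound := fun s => M * (1 + ‖s‖ ^ 2) ^ (-(m + 1 : ℝ) / 2))
    (fun x => ?_) (fun x => Eventually.of_forall fun s => ?_)
    ((integrable_poissonWeight m).const_mul M) (Eventually.of_forall fun s => ?_)
  · refine AEStronglyMeasurable.mul ?_ (integrable_poissonWeight m).aestronglyMeasurable
    exact (hg.comp (by fun_prop)).aestronglyMeasurable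
  · have h2 : 0 ≤ (1 + ‖s‖ ^ 2) ^ (-(m + 1 : ℝ) / 2) := by positivity
    rw [norm_mul, Real.norm_of_nonneg h2]
    exact mul_le_mul_of_nonneg_right (hM _) h2
  · exact (hg.comp (continuous_tangentialPart.sub (continuous_coord_last.smul
      continuous_const))).mul continuous_const

theorem dilatedPoissonIntegral_of_last_eq_zero {x : EuclideanSpace ℝ (Fin (m + 1))}
    (hx : x (Fin.last m) = 0) : dilatedPoissonIntegral g x = g (tangentialPart x) := by
  have hω := sphereArea_pos (Nat.succ_pos m)
  simp only [dilatedPoissonIntegral, hx, zero_smul, sub_zero]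
  rw [integral_const_mul, integral_poissonWeight]
  field_simp

theorem dilatedPoissonIntegral_eq {x : EuclideanSpace ℝ (Fin (m + 1))}
    (hx : x ∈ upperHalfSpace m) : dilatedPoissonIntegral g x = poissonIntegral g x := by
  rw [dilatedPoissonIntegral, poissonIntegral, kernelIntegral]
  congr 1
  set t := x (Fin.last m) with ht
  have htpos : 0 < t := hx
  set y := tangentialPart x
  have h1 : ∀ z, g z • poissonCore m (x - halfSpacePoint z 0) =
      (fun z => g (y - z) * poissonCore m (halfSpacePoint z t)) (y - z) := by
    intro z
    conv_lhs => rw [← halfSpacePoint_tangentialPart x]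
    rw [halfSpacePoint_sub, sub_zero, smul_eq_mul]
    simp only [sub_sub_cancel]
    rfl
  simp_rw [h1]
  rw [integral_sub_left_eq_self (fun z => g (y - z) * poissonCore m (halfSpacePoint z t)) volume y]
  have h2 := Measure.integral_comp_smul (volume : Measure (EuclideanSpace ℝ (Fin m)))
    (fun z => g (y - z) * poissonCore m (halfSpacePoint z t)) t
  have h3 : ∀ s : EuclideanSpace ℝ (Fin m),
      g (y - t • s) * poissonCore m (halfSpacePoint (t • s) t) =
      (t ^ m)⁻¹ * (g (y - t • s) * (1 + ‖s‖ ^ 2) ^ (-(m + 1 : ℝ) / 2)) := by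
    intro s
    have h4 := poissonCore_smul m t htpos (halfSpacePoint s 1)
    rw [smul_halfSpacePoint, mul_one] at h4
    rw [h4, poissonCore, norm_sq_rpow_halfSpacePoint_one, inner_normalVec, halfSpacePoint_last,
      Real.rpow_neg htpos.le, Real.rpow_natCast, smul_eq_mul]
    ring
  simp_rw [h3] at h2
  have h5 : 0 < (t ^ m)⁻¹ := by positivity
  rw [integral_const_mul, finrank_euclideanSpace_fin, abs_of_pos h5, smul_eq_mul] at h2
  exact mul_left_cancel₀ h5.ne' h2

variable {u : EuclideanSpace ℝ (Fin (m + 1)) → ℝ}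

theorem smul_normalVec_add_mem {ε : ℝ} (hε : 0 < ε) {x : EuclideanSpace ℝ (Fin (m + 1))}
    (hx : 0 ≤ x (Fin.last m)) : ε • normalVec m + x ∈ upperHalfSpace m := by
  change 0 < (ε • normalVec m + x) (Fin.last m)
  simp [normalVec]
  positivity

/-- A bounded harmonic function in the half-space is, at height `ε` and above, the Poisson integral
of its values at height `ε`. -/
theorem BoundedHarmonicOn.eq_poissonIntegral (hu : BoundedHarmonicOn u (upperHalfSpace m))
    {ε : ℝ} (hε : 0 < ε) {x : EuclideanSpace ℝ (Fin (m + 1))} (hx : x ∈ upperHalfSpace m) :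
    u (ε • normalVec m + x) = poissonIntegral (fun z => u (halfSpacePoint z ε)) x := by
  obtain ⟨M, hM⟩ := hu.bounded
  set g : EuclideanSpace ℝ (Fin m) → ℝ := fun z => u (halfSpacePoint z ε) with hg
  have hgM : ∀ z, |g z| ≤ M := fun z => hM _ (halfSpacePoint_mem hε)
  have hgc : Continuous g := hu.harmonic.continuousOn.comp_continuous
    (continuous_halfSpacePoint_left ε) fun z => halfSpacePoint_mem hε
  have hc1 : ContinuousOn (fun x => u (ε • normalVec m + x)) {x | 0 ≤ x (Fin.last m)} :=
    hu.harmonic.continuousOn.comp (by fun_prop) fun x hx => smul_normalVec_add_mem hε hx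
  have hc2 := (continuous_dilatedPoissonIntegral hgc hgM).continuousOn (s :=
    {x : EuclideanSpace ℝ (Fin (m + 1)) | 0 ≤ x (Fin.last m)})
  have hh1 : HarmonicOnNhd (fun x => u (ε • normalVec m + x)) (upperHalfSpace m) := fun x hx =>
    HarmonicAt.comp_affineIsometry (ε • normalVec m) (LinearIsometryEquiv.refl ℝ _)
      (hu.harmonic _ (smul_normalVec_add_mem hε (le_of_lt hx)))
  have hh2 : HarmonicOnNhd (dilatedPoissonIntegral g) (upperHalfSpace m) := fun x hx => by
    refine (harmonicAt_congr_nhds ?_).2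
      (harmonicOnNhd_poissonIntegral hgc.aestronglyMeasurable hgM x hx)
    filter_upwards [(isOpen_upperHalfSpace m).mem_nhds hx] with y hy
    exact dilatedPoissonIntegral_eq hy
  have hb1 : ∀ x ∈ upperHalfSpace m, |u (ε • normalVec m + x)| ≤ M := fun x hx =>
    hM _ (smul_normalVec_add_mem hε (le_of_lt hx))
  have hb2 : ∀ x ∈ upperHalfSpace m, |dilatedPoissonIntegral g x| ≤ M := fun x hx => by
    rw [dilatedPoissonIntegral_eq hx]
    exact abs_poissonIntegral_le hgM hx
  have h0 : ∀ x : EuclideanSpace ℝ (Fin (m + 1)), x (Fin.last m) = 0 →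
      u (ε • normalVec m + x) = dilatedPoissonIntegral g x := by
    intro x hx
    rw [dilatedPoissonIntegral_of_last_eq_zero hx, hg]
    simp only
    congr 1
    conv_lhs => rw [← halfSpacePoint_tangentialPart x]
    rw [hx, ← halfSpacePoint_zero_eq, halfSpacePoint_add, zero_add, add_zero]
  rw [← dilatedPoissonIntegral_eq hx]
  refine le_antisymm (sub_nonpos.1 ?_) (sub_nonpos.1 ?_)
  · refine nonpos_of_harmonic_of_boundary_nonpos (M := M + M) (hc1.sub hc2) (hh1.sub hh2)
      (fun y hy => ?_) (fun y hy => (sub_eq_zero.2 (h0 y hy)).le) hx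
    have := (abs_sub (u (ε • normalVec m + y)) (dilatedPoissonIntegral g y)).trans
      (add_le_add (hb1 y hy) (hb2 y hy))
    exact (le_abs_self _).trans this
  · refine nonpos_of_harmonic_of_boundary_nonpos (M := M + M) (hc2.sub hc1) (hh2.sub hh1)
      (fun y hy => ?_) (fun y hy => (sub_eq_zero.2 (h0 y hy).symm).le) hx
    have := (abs_sub (dilatedPoissonIntegral g y) (u (ε • normalVec m + y))).trans
      (add_le_add (hb2 y hy) (hb1 y hy))
    exact (le_abs_self _).trans this

theorem hasFDerivAt_poissonIntegral (hg : AEStronglyMeasurable g volume) (hM : ∀ z, |g z| ≤ M)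
    {x : EuclideanSpace ℝ (Fin (m + 1))} (hx : x ∈ upperHalfSpace m) :
    HasFDerivAt (poissonIntegral g) ((2 / sphereArea (m + 1)) •
      kernelIntegral g (fderiv ℝ (poissonCore m)) x) x :=
  (hasFDerivAt_kernelIntegral_poissonCore hg hM hx).const_mul _

theorem kernelIntegral_fderiv_apply (hg : AEStronglyMeasurable g volume) (hM : ∀ z, |g z| ≤ M)
    {x : EuclideanSpace ℝ (Fin (m + 1))} (hx : x ∈ upperHalfSpace m)
    (v : EuclideanSpace ℝ (Fin (m + 1))) :
    kernelIntegral g (fderiv ℝ (poissonCore m)) x v =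
      ∫ z, g z * fderiv ℝ (poissonCore m) (x - halfSpacePoint z 0) v := by
  rw [kernelIntegral, ContinuousLinearMap.integral_apply (integrable_kernel hg hM
    continuousOn_fderiv_poissonCore hasPoissonDecay_fderiv_poissonCore hx)]
  rfl

end Representation

/-! ### The gradient estimate in the half-space -/

section GradientEstimate

variable {m : ℕ} {u : EuclideanSpace ℝ (Fin (m + 1)) → ℝ}

theorem boundaryNorm_le {M : ℝ} (hM : ∀ x ∈ upperHalfSpace m, |u x| ≤ M) :
    boundaryNorm u ≤ ENNReal.ofReal M := by
  refine essSup_le_of_ae_le _ (Eventually.of_forall fun y => ?_)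
  refine limsup_le_of_le (by isBoundedDefault) ?_
  filter_upwards [self_mem_nhdsWithin] with t ht
  rw [← ofReal_norm]
  exact ENNReal.ofReal_le_ofReal (hM _ (halfSpacePoint_mem ht))

theorem BoundedHarmonicOn.boundaryNorm_ne_top (hu : BoundedHarmonicOn u (upperHalfSpace m)) :
    boundaryNorm u ≠ ⊤ := by
  obtain ⟨M, hM⟩ := hu.bounded
  exact ((boundaryNorm_le hM).trans_lt ENNReal.ofReal_lt_top).ne

/-- The directional derivative at height `ε` above `x`, estimated through the values at height
`ε`. -/
theorem BoundedHarmonicOn.ofReal_abs_fderiv_shift_le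
    (hu : BoundedHarmonicOn u (upperHalfSpace m)) {ε : ℝ} (hε : 0 < ε)
    {x : EuclideanSpace ℝ (Fin (m + 1))} (hx : x ∈ upperHalfSpace m)
    (v : EuclideanSpace ℝ (Fin (m + 1))) :
    ENNReal.ofReal |fderiv ℝ u (ε • normalVec m + x) v| ≤
      ENNReal.ofReal (2 / sphereArea (m + 1)) * ∫⁻ z : EuclideanSpace ℝ (Fin m),
        ‖fderiv ℝ (poissonCore m) (x - halfSpacePoint z 0) v‖ₑ * ‖u (halfSpacePoint z ε)‖ₑ := by
  obtain ⟨M, hM⟩ := hu.bounded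
  have hω := sphereArea_pos (Nat.succ_pos m)
  have hgM : ∀ z : EuclideanSpace ℝ (Fin m), |u (halfSpacePoint z ε)| ≤ M := fun z =>
    hM _ (halfSpacePoint_mem hε)
  have hgc : Continuous fun z : EuclideanSpace ℝ (Fin m) => u (halfSpacePoint z ε) :=
    hu.harmonic.continuousOn.comp_continuous
      (continuous_halfSpacePoint_left ε) fun z => halfSpacePoint_mem hε
  have h1 : (fun y => u (ε • normalVec m + y)) =ᶠ[𝓝 x]
      poissonIntegral fun z => u (halfSpacePoint z ε) := by
    filter_upwards [(isOpen_upperHalfSpace m).mem_nhds hx] with y hy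
    exact hu.eq_poissonIntegral hε hy
  have h2 := (hasFDerivAt_poissonIntegral hgc.aestronglyMeasurable hgM hx).congr_of_eventuallyEq h1
  have h3 := h2.fderiv
  rw [fderiv_comp_add_left] at h3
  rw [h3, smul_apply, smul_eq_mul, abs_mul, abs_of_pos (by positivity),
    ENNReal.ofReal_mul (by positivity),
    kernelIntegral_fderiv_apply hgc.aestronglyMeasurable hgM hx, ← Real.norm_eq_abs,
    ofReal_norm]
  gcongr
  refine (enorm_integral_le_lintegral_enorm _).trans_eq (lintegral_congr fun z => ?_)
  rw [enorm_mul, mul_comm]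

theorem limsup_seq_le_limsup_boundary (F : ℝ → ℝ≥0∞) :
    limsup (fun k : ℕ => F (1 / ((k : ℝ) + 1))) atTop ≤ limsup F (𝓝[>] 0) := by
  have h : Tendsto (fun k : ℕ => 1 / ((k : ℝ) + 1)) atTop (𝓝[>] 0) :=
    tendsto_nhdsWithin_iff.2 ⟨tendsto_one_div_add_atTop_nhds_zero_nat,
      Eventually.of_forall fun k => by
        change (0 : ℝ) < 1 / ((k : ℝ) + 1)
        positivity⟩
  exact (limsup_comp F _ _).trans_le (limsup_le_limsup_of_le h)

/-- Letting the height tend to zero: the reverse Fatou lemma replaces the boundary values. -/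
theorem BoundedHarmonicOn.abs_fderiv_le (hu : BoundedHarmonicOn u (upperHalfSpace m))
    {x : EuclideanSpace ℝ (Fin (m + 1))} (hx : x ∈ upperHalfSpace m)
    (v : EuclideanSpace ℝ (Fin (m + 1))) :
    |fderiv ℝ u x v| ≤ 2 / sphereArea (m + 1) *
      (∫ z, |fderiv ℝ (poissonCore m) (x - halfSpacePoint z 0) v|) * (boundaryNorm u).toReal := by
  obtain ⟨M, hM⟩ := hu.bounded
  have hω := sphereArea_pos (Nat.succ_pos m)
  set Ψ : EuclideanSpace ℝ (Fin m) → ℝ≥0∞ := fun z =>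
    ‖fderiv ℝ (poissonCore m) (x - halfSpacePoint z 0) v‖ₑ with hΨ
  have hint := (integrable_fderiv_poissonCore hx).apply_continuousLinearMap v
  have hΨint : ∫⁻ z, Ψ z =
      ENNReal.ofReal (∫ z, |fderiv ℝ (poissonCore m) (x - halfSpacePoint z 0) v|) := by
    rw [hΨ]
    exact (ofReal_integral_norm_eq_lintegral_enorm hint).symm
  have hΨm : Measurable Ψ := by
    refine Continuous.measurable (Continuous.enorm ?_)
    exact (continuousOn_fderiv_poissonCore.comp_continuous
      (continuous_const.sub (continuous_halfSpacePoint_left 0))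
      (sub_halfSpacePoint_zero_mem hx)).clm_apply continuous_const
  set ε : ℕ → ℝ := fun k => 1 / ((k : ℝ) + 1) with hεdef
  have hε : ∀ k, 0 < ε k := fun k => by positivity
  have hlim : Tendsto (fun k => ENNReal.ofReal |fderiv ℝ u (ε k • normalVec m + x) v|) atTop
      (𝓝 (ENNReal.ofReal |fderiv ℝ u x v|)) := by
    have h1 : ContinuousAt (fderiv ℝ u) x :=
      ((hu.harmonic x hx).1.fderiv_right (m := 0) (by norm_num)).continuousAt
    have h2 : Tendsto (fun k => ε k • normalVec m + x) atTop (𝓝 x) := by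
      have := ((tendsto_one_div_add_atTop_nhds_zero_nat (𝕜 := ℝ)).smul_const
        (normalVec m)).add_const x
      rwa [zero_smul, zero_add] at this
    have h3 : ContinuousAt (fun y => ENNReal.ofReal |fderiv ℝ u y v|) x :=
      ENNReal.continuous_ofReal.continuousAt.comp (h1.clm_apply continuousAt_const).abs
    exact h3.tendsto.comp h2
  have hmeas : ∀ k, Measurable fun z : EuclideanSpace ℝ (Fin m) =>
      Ψ z * ‖u (halfSpacePoint z (ε k))‖ₑ := fun k => by
    refine hΨm.mul (Continuous.measurable (Continuous.enorm ?_))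
    exact hu.harmonic.continuousOn.comp_continuous
      (continuous_halfSpacePoint_left (ε k)) fun z => halfSpacePoint_mem (hε k)
  have hfatou : limsup (fun k => ∫⁻ z, Ψ z * ‖u (halfSpacePoint z (ε k))‖ₑ) atTop ≤
      (∫⁻ z, Ψ z) * boundaryNorm u := by
    refine (limsup_lintegral_le (fun z => Ψ z * ENNReal.ofReal M) hmeas (fun k =>
      Eventually.of_forall fun z => ?_) ?_).trans ?_
    · change Ψ z * _ ≤ Ψ z * _
      gcongr
      rw [← ofReal_norm]
      exact ENNReal.ofReal_le_ofReal (hM _ (halfSpacePoint_mem (hε k)))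
    · rw [lintegral_mul_const _ hΨm, hΨint]
      exact ENNReal.mul_ne_top ENNReal.ofReal_ne_top ENNReal.ofReal_ne_top
    · rw [← lintegral_mul_const _ hΨm]
      refine lintegral_mono_ae ?_
      filter_upwards [ae_le_essSup (f := fun y : EuclideanSpace ℝ (Fin m) =>
        limsup (fun t : ℝ => ‖u (halfSpacePoint y t)‖ₑ) (𝓝[>] 0)) (μ := volume)] with z hz
      rw [ENNReal.limsup_const_mul_of_ne_top enorm_ne_top]
      gcongr
      exact (limsup_seq_le_limsup_boundary fun t => ‖u (halfSpacePoint z t)‖ₑ).trans hz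
  have hmain : ENNReal.ofReal |fderiv ℝ u x v| ≤
      ENNReal.ofReal (2 / sphereArea (m + 1)) * ((∫⁻ z, Ψ z) * boundaryNorm u) := by
    rw [← hlim.limsup_eq]
    refine (limsup_le_limsup (Eventually.of_forall fun k =>
      hu.ofReal_abs_fderiv_shift_le (hε k) hx v)).trans ?_
    rw [ENNReal.limsup_const_mul_of_ne_top ENNReal.ofReal_ne_top]
    gcongr
  rw [hΨint, ← ENNReal.ofReal_toReal hu.boundaryNorm_ne_top, ← ENNReal.ofReal_mul (by positivity),
    ← ENNReal.ofReal_mul (by positivity)] at hmain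
  rw [mul_assoc]
  exact (ENNReal.ofReal_le_ofReal_iff (by positivity)).1 hmain

theorem norm_gradient_eq {E : Type*} [NormedAddCommGroup E] [InnerProductSpace ℝ E]
    [CompleteSpace E] (f : E → ℝ) (x : E) : ‖gradient f x‖ = ‖fderiv ℝ f x‖ := by
  rw [gradient, LinearIsometryEquiv.norm_map]

theorem BoundedHarmonicOn.norm_gradient_le (hm : 1 ≤ m)
    (hu : BoundedHarmonicOn u (upperHalfSpace m))
    {x : EuclideanSpace ℝ (Fin (m + 1))} (hx : x ∈ upperHalfSpace m) :
    ‖gradient u x‖ ≤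
      gradConst (m + 1) * (x (Fin.last m))⁻¹ * (boundaryNorm u).toReal := by
  have hω := sphereArea_pos (Nat.succ_pos m)
  have hC := gradConst_pos hm
  have hx0 : 0 < x (Fin.last m) := hx
  rw [norm_gradient_eq]
  refine ContinuousLinearMap.opNorm_le_of_unit_norm (by positivity) fun v hv => ?_
  refine (hu.abs_fderiv_le hx v).trans (mul_le_mul_of_nonneg_right ?_ ENNReal.toReal_nonneg)
  rw [integral_abs_fderiv_poissonCore v hx]
  calc 2 / sphereArea (m + 1) * ((x (Fin.last m))⁻¹ *
        ∫ z : EuclideanSpace ℝ (Fin m), |fderiv ℝ (poissonCore m) (halfSpacePoint z 1) v|)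
      ≤ 2 / sphereArea (m + 1) * ((x (Fin.last m))⁻¹ *
        (gradConst (m + 1) * (sphereArea (m + 1) / 2))) := by
        gcongr
        exact integral_abs_fderiv_poissonCore_one_le hm hv
    _ = gradConst (m + 1) * (x (Fin.last m))⁻¹ := by field_simp

/-- The extremal function at `x`: the Poisson integral of the sign of the normal derivative of
the kernel. -/
theorem exists_boundedHarmonicOn_gradConst_le (hm : 1 ≤ m)
    {x : EuclideanSpace ℝ (Fin (m + 1))} (hx : x ∈ upperHalfSpace m) :
    ∃ u : EuclideanSpace ℝ (Fin (m + 1)) → ℝ, BoundedHarmonicOn u (upperHalfSpace m) ∧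
      boundaryNorm u ≤ 1 ∧ gradConst (m + 1) * (x (Fin.last m))⁻¹ ≤ ‖gradient u x‖ := by
  have hω := sphereArea_pos (Nat.succ_pos m)
  set φ : EuclideanSpace ℝ (Fin m) → ℝ := fun z =>
    fderiv ℝ (poissonCore m) (x - halfSpacePoint z 0) (normalVec m) with hφ
  have hφm : Measurable φ := Continuous.measurable <|
    (continuousOn_fderiv_poissonCore.comp_continuous
      (continuous_const.sub (continuous_halfSpacePoint_left 0))
      (sub_halfSpacePoint_zero_mem hx)).clm_apply continuous_const
  set g : EuclideanSpace ℝ (Fin m) → ℝ := fun z => if 0 ≤ φ z then 1 else -1 with hg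
  have hgm : AEStronglyMeasurable g volume :=
    (Measurable.ite (measurableSet_le measurable_const hφm) measurable_const
      measurable_const).aestronglyMeasurable
  have hgM : ∀ z, |g z| ≤ 1 := fun z => by
    simp only [hg]
    split_ifs <;> simp
  have hgφ : ∀ z, g z * φ z = |φ z| := fun z => by
    simp only [hg]
    split_ifs with h
    · rw [abs_of_nonneg h, one_mul]
    · rw [abs_of_neg (not_le.1 h), neg_one_mul]
  have hb : ∀ y ∈ upperHalfSpace m, |poissonIntegral g y| ≤ 1 := fun y hy =>
    abs_poissonIntegral_le hgM hy
  refine ⟨poissonIntegral g, ⟨harmonicOnNhd_poissonIntegral hgm hgM, 1, hb⟩, ?_, ?_⟩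
  · simpa using boundaryNorm_le hb
  · rw [norm_gradient_eq, (hasFDerivAt_poissonIntegral hgm hgM hx).fderiv]
    refine le_trans (le_of_eq ?_) ((Real.le_norm_self _).trans
      (ContinuousLinearMap.unit_le_opNorm _ (normalVec m) (norm_normalVec m).le))
    rw [smul_apply, kernelIntegral_fderiv_apply hgm hgM hx, integral_congr_ae
      (Eventually.of_forall hgφ), integral_abs_fderiv_poissonCore _ hx,
      integral_abs_fderiv_poissonCore_normalVec hm, smul_eq_mul]
    field_simp

theorem isLeast_gradConst (hm : 1 ≤ m) {x : EuclideanSpace ℝ (Fin (m + 1))}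
    (hx : x ∈ upperHalfSpace m) :
    IsLeast {C : ℝ | ∀ u : EuclideanSpace ℝ (Fin (m + 1)) → ℝ,
          BoundedHarmonicOn u (upperHalfSpace m) →
          ‖gradient u x‖ ≤ C * (x (Fin.last m))⁻¹ * (boundaryNorm u).toReal}
        (gradConst (m + 1)) := by
  refine ⟨fun u hu => hu.norm_gradient_le hm hx, fun C hC => ?_⟩
  have hx0 : 0 < (x (Fin.last m))⁻¹ := inv_pos.2 hx
  obtain ⟨u, hu, hu1, hu2⟩ := exists_boundedHarmonicOn_gradConst_le hm hx
  have h1 := hu2.trans (hC u hu)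
  have h2 : (boundaryNorm u).toReal ≤ 1 := by
    simpa using ENNReal.toReal_mono ENNReal.one_ne_top hu1
  have h3 : 0 ≤ (boundaryNorm u).toReal := ENNReal.toReal_nonneg
  have h4 := gradConst_pos hm
  rcases le_total 0 C with hC0 | hC0
  · have h5 : C * (x (Fin.last m))⁻¹ * (boundaryNorm u).toReal ≤ C * (x (Fin.last m))⁻¹ :=
      mul_le_of_le_one_right (by positivity) h2
    exact le_of_mul_le_mul_right (h1.trans h5) hx0
  · have h5 : C * (x (Fin.last m))⁻¹ * (boundaryNorm u).toReal ≤ 0 :=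
      mul_nonpos_of_nonpos_of_nonneg (mul_nonpos_of_nonpos_of_nonneg hC0 hx0.le) h3
    have h6 : 0 < gradConst (m + 1) * (x (Fin.last m))⁻¹ := by positivity
    linarith

end GradientEstimate

/-! ### The complement of a convex set -/

section ConvexComplement

/-- A supporting half-space at the nearest point: a point outside a closed convex set has a nearest
point `p`, which lies on the boundary, and the set lies on the far side of the hyperplane through
`p` orthogonal to `x - p`. -/
theorem exists_supporting_frontier {E : Type*} [NormedAddCommGroup E] [InnerProductSpace ℝ E]
    [CompleteSpace E] {K : Set E} (hK : IsClosed K) (hne : K.Nonempty) (hconv : Convex ℝ K) {x : E}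
    (hx : x ∉ K) : ∃ p ∈ frontier K, ∀ w ∈ K, inner ℝ (x - p) (w - p) ≤ 0 := by
  obtain ⟨p, hp, hmin⟩ := exists_norm_eq_iInf_of_complete_convex hne hK.isComplete hconv x
  have hle := (norm_eq_iInf_iff_real_inner_le_zero hconv hp).1 hmin
  refine ⟨p, ⟨subset_closure hp, fun hint => ?_⟩, hle⟩
  have hlim : Tendsto (fun s : ℝ => p + s • (x - p)) (𝓝[>] 0) (𝓝 p) := by
    have : Continuous fun s : ℝ => p + s • (x - p) := by fun_prop
    simpa using (this.tendsto 0).mono_left nhdsWithin_le_nhds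
  have hev := (hlim.eventually (mem_interior_iff_mem_nhds.1 hint)).and self_mem_nhdsWithin
  obtain ⟨s, hs, hs0⟩ := hev.exists
  have h1 := hle _ hs
  rw [add_sub_cancel_left, inner_smul_right, real_inner_self_eq_norm_sq] at h1
  have h2 : 0 < ‖x - p‖ := norm_sub_pos_iff.2 fun h => hx (h ▸ hp)
  have h3 : (0 : ℝ) < s := hs0
  have : 0 < s * ‖x - p‖ ^ 2 := by positivity
  linarith

variable {m : ℕ}

/-- The half-space estimate transported to the half-space bounded by the hyperplane through `p`
orthogonal to `x - p`. -/
theorem norm_gradient_le_of_halfSpace_subset (hm : 1 ≤ m)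
    {Ω : Set (EuclideanSpace ℝ (Fin (m + 1)))} {u : EuclideanSpace ℝ (Fin (m + 1)) → ℝ}
    (hu : HarmonicOnNhd u Ω) {S : ℝ} (hS : ∀ y ∈ Ω, |u y| ≤ S)
    {x p : EuclideanSpace ℝ (Fin (m + 1))} (hxp : x ≠ p)
    (hΩ : ∀ y, 0 < inner ℝ (x - p) (y - p) → y ∈ Ω) :
    ‖gradient u x‖ ≤ gradConst (m + 1) / ‖x - p‖ * S := by
  set d := ‖x - p‖ with hd
  have hd0 : 0 < d := norm_sub_pos_iff.2 hxp
  have hunit : ‖normalVec m‖ = ‖d⁻¹ • (x - p)‖ := by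
    rw [norm_normalVec, norm_smul, ← hd, Real.norm_of_nonneg (by positivity),
      inv_mul_cancel₀ hd0.ne']
  set T : EuclideanSpace ℝ (Fin (m + 1)) ≃ₗᵢ[ℝ] EuclideanSpace ℝ (Fin (m + 1)) :=
    (ℝ ∙ (normalVec m - d⁻¹ • (x - p)))ᗮ.reflection
  have hT : T (normalVec m) = d⁻¹ • (x - p) := Submodule.reflection_sub hunit
  have hTd : x - p = d • T (normalVec m) := by rw [hT, smul_inv_smul₀ hd0.ne']
  have hmem : ∀ y ∈ upperHalfSpace m, p + T y ∈ Ω := by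
    intro y hy
    refine hΩ _ ?_
    have : 0 < y (Fin.last m) := hy
    rw [hTd, add_sub_cancel_left, inner_smul_left, T.inner_map_map, inner_normalVec]
    simp
    positivity
  set w : EuclideanSpace ℝ (Fin (m + 1)) → ℝ := fun y => u (p + T y) with hw
  have hwS : ∀ y ∈ upperHalfSpace m, |w y| ≤ S := fun y hy => hS _ (hmem y hy)
  have hwh : BoundedHarmonicOn w (upperHalfSpace m) :=
    ⟨fun y hy => HarmonicAt.comp_affineIsometry p T (hu _ (hmem y hy)), S, hwS⟩
  have hdlast : (d • normalVec m) (Fin.last m) = d := by simp [normalVec]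
  have hdm : d • normalVec m ∈ upperHalfSpace m := by
    change 0 < (d • normalVec m) (Fin.last m)
    rwa [hdlast]
  have hx : p + T (d • normalVec m) = x := by rw [map_smul, ← hTd, add_sub_cancel]
  have hfd : ‖fderiv ℝ w (d • normalVec m)‖ = ‖fderiv ℝ u x‖ := by
    have h1 : DifferentiableAt ℝ u (p + T (d • normalVec m)) :=
      (hu _ (hmem _ hdm)).1.differentiableAt (by simp)
    have h2 : HasFDerivAt (fun y => p + T y)
        (T.toContinuousLinearEquiv : EuclideanSpace ℝ (Fin (m + 1)) →L[ℝ] _) (d • normalVec m) :=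
      (T.toContinuousLinearEquiv.hasFDerivAt).const_add p
    have h3 : HasFDerivAt w _ (d • normalVec m) :=
      h1.hasFDerivAt.comp (f := fun y => p + T y) (d • normalVec m) h2
    rw [h3.fderiv, hx]
    exact ContinuousLinearMap.opNorm_comp_linearIsometryEquiv _ T
  have hS0 : 0 ≤ S := (abs_nonneg _).trans (hwS _ hdm)
  have hnorm : (boundaryNorm w).toReal ≤ S := by
    have := ENNReal.toReal_mono ENNReal.ofReal_ne_top (boundaryNorm_le hwS)
    rwa [ENNReal.toReal_ofReal hS0] at this
  have hC := gradConst_pos hm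
  have h := hwh.norm_gradient_le hm hdm
  rw [norm_gradient_eq, hfd, ← norm_gradient_eq, hdlast, ← div_eq_mul_inv] at h
  exact h.trans (by gcongr)

theorem norm_gradient_le_of_convex_compl (hm : 1 ≤ m) {G : Set (EuclideanSpace ℝ (Fin (m + 1)))}
    (hne : G.Nonempty) (hconv : Convex ℝ G) {u : EuclideanSpace ℝ (Fin (m + 1)) → ℝ}
    (hu : BoundedHarmonicOn u (closure G)ᶜ) {x : EuclideanSpace ℝ (Fin (m + 1))}
    (hx : x ∈ (closure G)ᶜ) :
    ‖gradient u x‖ ≤ gradConst (m + 1) / Metric.infDist x (frontier (closure G)ᶜ) *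
      ⨆ y : ((closure G)ᶜ : Set (EuclideanSpace ℝ (Fin (m + 1)))), |u y| := by
  obtain ⟨p, hp, hle⟩ :=
    exists_supporting_frontier isClosed_closure hne.closure hconv.closure hx
  obtain ⟨M, hM⟩ := hu.bounded
  have hS : ∀ y ∈ (closure G)ᶜ, |u y| ≤
      ⨆ y : ((closure G)ᶜ : Set (EuclideanSpace ℝ (Fin (m + 1)))), |u y| := fun y hy =>
    le_ciSup (f := fun y : ((closure G)ᶜ : Set (EuclideanSpace ℝ (Fin (m + 1)))) => |u y|)
      ⟨M, by rintro _ ⟨z, rfl⟩; exact hM z z.2⟩ ⟨y, hy⟩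
  have hfr : frontier (closure G) ⊆ closure G := isClosed_closure.frontier_subset
  have hxp : x ≠ p := fun h => hx (h ▸ hfr hp)
  refine (norm_gradient_le_of_halfSpace_subset hm hu.harmonic hS hxp fun y hy hyG =>
    (hle y hyG).not_gt hy).trans ?_
  rw [frontier_compl]
  have h1 : Metric.infDist x (frontier (closure G)) ≤ ‖x - p‖ := by
    rw [← dist_eq_norm]
    exact Metric.infDist_le_dist_of_mem hp
  -- the distance is positive, so that the division by it is not degenerate
  have h2 : 0 < Metric.infDist x (frontier (closure G)) :=
    (isClosed_frontier.notMem_iff_infDist_pos ⟨p, hp⟩).1 fun h => hx (hfr h)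
  have h3 := gradConst_pos hm
  have h4 := (abs_nonneg _).trans (hS x hx)
  gcongr

end ConvexComplement

/-! ### Values of the constant in dimensions two and three -/

section Values

theorem sphereArea_one : sphereArea 1 = 2 := by
  have h : (volume : Measure (EuclideanSpace ℝ (Fin 1))).real (Metric.ball 0 1) = 2 := by
    rw [measureReal_def, InnerProductSpace.volume_ball_of_dim_odd (k := 0) (by simp)]
    simp
  rw [sphereArea_eq, h]
  simp

theorem sphereArea_two : sphereArea 2 = 2 * Real.pi := by
  rw [sphereArea_eq, measureReal_def, EuclideanSpace.volume_ball_fin_two]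
  simp [Real.pi_pos.le]

theorem sphereArea_three : sphereArea 3 = 4 * Real.pi := by
  rw [sphereArea_eq, measureReal_def, EuclideanSpace.volume_ball_fin_three]
  rw [ENNReal.toReal_mul, ENNReal.toReal_ofReal (by positivity)]
  simp
  ring

theorem gradConst_two : gradConst 2 = 2 / Real.pi := by
  rw [gradConst, sphereArea_one, sphereArea_two]
  norm_num
  field_simp
  norm_num

theorem gradConst_three : gradConst 3 = 4 / (3 * Real.sqrt 3) := by
  rw [gradConst, sphereArea_two, sphereArea_three]
  have h : (3 : ℝ) ^ ((3 : ℝ) / 2) = 3 * √3 := by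
    rw [show (3 : ℝ) / 2 = 1 + 1 / 2 by norm_num, Real.rpow_add (by norm_num), Real.rpow_one,
      ← Real.sqrt_eq_rpow]
  push_cast
  rw [h]
  norm_num
  field_simp
  norm_num

end Values

theorem theorem1 :
    -- the gradient estimate in the complement of a closed convex domain
    (∀ n : ℕ, 2 ≤ n → ∀ G Ω : Set (EuclideanSpace ℝ (Fin n)),
      IsOpen G → G.Nonempty → Convex ℝ G → Ω = (closure G)ᶜ →
      ∀ u : EuclideanSpace ℝ (Fin n) → ℝ, BoundedHarmonicOn u Ω →
      ∀ x ∈ Ω, ‖gradient u x‖ ≤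
        gradConst n / Metric.infDist x (frontier Ω) * ⨆ y : Ω, |u y|) ∧
    -- in dimension `n = m + 1 ≥ 2`, at every point `x` of the half-space, `C_n` is the least
    -- constant in the estimate of the gradient at `x` through the boundary values
    (∀ m : ℕ, 1 ≤ m → ∀ x ∈ upperHalfSpace m,
      IsLeast {C : ℝ | ∀ u : EuclideanSpace ℝ (Fin (m + 1)) → ℝ,
          BoundedHarmonicOn u (upperHalfSpace m) →
          ‖gradient u x‖ ≤ C * (x (Fin.last m))⁻¹ * (boundaryNorm u).toReal}
        (gradConst (m + 1))) ∧
    gradConst 2 = 2 / Real.pi ∧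
    gradConst 3 = 4 / (3 * Real.sqrt 3) := by
  refine ⟨fun n hn G Ω _ hne hconv hΩ u hu x hx => ?_, fun m hm x hx => isLeast_gradConst hm hx,
    gradConst_two, gradConst_three⟩
  obtain ⟨m, rfl⟩ := Nat.exists_eq_add_of_le' (one_le_two.trans hn)
  subst hΩ
  exact norm_gradient_le_of_convex_compl (by omega) hne hconv hu hx
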